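/- Let $n\ge 3$ and $H(x)=x_1^2+\cdots+x_n^2-x_1x_2\cdots x_n$ for $x\in\mathbb C^n$. Let $\Gamma_n=\langle b_1,\dots,b_n\mid b_1^2=\cdots=b_n^2=1\rangle$ act on $\mathbb C^n$, where $b_i$ replaces the coordinate $x_i$ by $\prod_{j\ne i}x_j-x_i$ and fixes the other coordinates. Let $\Delta$ be the Cayley tree of $\Gamma_n$: its vertices are the elements of $\Gamma_n$, and $g,h$ are joined by an edge labelled $i$ if and only if $g=hb_i$. For $1\le i<j\le n$, an alternating $\{i,j\}$-geodesic is a connected component of the graph obtained from $\Delta$ by keeping all vertices and only the edges labelled $i$ or $j$ (a bi-infinite geodesic whose edges are labelled alternately $i$ and $j$). Let $\mathcal A$ be the set of all alternating geodesics, over all pairs $i<j$. For $a\in\mathbb C^n$ and a vertex $g$ let $\Phi_a(g)=g^{-1}(a)$. If $\gamma$ is an alternating $\{i,j\}$-geodesic, $g$ is a vertex of $\gamma$ and $\Phi_a(g)=(x_1,\dots,x_n)$, put $$\phi(\gamma)=\prod_{k\ne i,j}x_k,\qquad \sigma(\gamma)=\sum_{k\ne i,j}x_k^2 ;$$ these do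 not depend on the choice of $g$. Let $\mathcal D\subset\mathbb C^n$ be the set of all $a$ such that (i) $\phi(\gamma)\notin[-2,2]$ for all $\gamma\in\mathcal A$, and (ii) for some real $K>2$ the set $\{\gamma\in\mathcal A: |\phi(\gamma)|\le K\}$ is finite. **Theorem.** Let $a\in\mathcal D$ and $\mu=H(a)$. Then $\sigma(\gamma)\ne\mu$ for all $\gamma\in\mathcal A$, so that $$\mathfrak h_\mu(\gamma)=1-\Bigl(1+\frac{2\mu}{n(n-1)(\sigma(\gamma)-\mu)}\Bigr)\sqrt{1-\frac{4}{\phi(\gamma)^2}}$$ is defined for all $\gamma\in\mathcal A$, where the square root is the one with non-negative real part; the series $\sum_{\gamma\in\mathcal A}\mathfrak h_\mu(\gamma)$ converges absolutely, and $$\sum_{\gamma\in\mathcal A}\mathfrak h_\mu(\gamma)=1 .$$ In particular, if $\mu=0$, then $\sum_{\gamma\in\mathcal A}h(\phi(\gamma))=1$ with absolute convergence, where $h(z)=1-\sqrt{1-4/z^2}$ for $z\ne 0$. -/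

import Mathlib

namespace MarkoffHurwitz

/-- The Markoff-Hurwitz polynomial `x₁² + ⋯ + xₙ² - x₁ ⋯ xₙ`. -/
def hurwitzPoly {n : ℕ} (x : Fin n → ℂ) : ℂ :=
  (∑ i, x i ^ 2) - ∏ i, x i

/-- The map of `ℂⁿ` that replaces `xᵢ` by the product of the other coordinates minus `xᵢ`. -/
def flipAt {n : ℕ} (i : Fin n) (x : Fin n → ℂ) : Fin n → ℂ :=
  Function.update x i ((∏ j ∈ Finset.univ.erase i, x j) - x i)

theorem flipAt_flipAt {n : ℕ} (i : Fin n) (x : Fin n → ℂ) : flipAt i (flipAt i x) = x := by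
  have h : ∏ j ∈ Finset.univ.erase i, flipAt i x j = ∏ j ∈ Finset.univ.erase i, x j :=
    Finset.prod_congr rfl fun j hj => by
      simp [flipAt, Function.update_of_ne (Finset.ne_of_mem_erase hj)]
  funext k
  by_cases hk : k = i
  · subst hk
    have : flipAt k (flipAt k x) k = ∏ j ∈ Finset.univ.erase k, flipAt k x j - flipAt k x k := by
      simp [flipAt]
    rw [this, h]
    simp [flipAt]
  · simp [flipAt, Function.update_of_ne hk]

/-- The involution `flipAt i` as a permutation of `ℂⁿ`. -/
def flipPerm {n : ℕ} (i : Fin n) : Equiv.Perm (Fin n → ℂ) where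
  toFun := flipAt i
  invFun := flipAt i
  left_inv := flipAt_flipAt i
  right_inv := flipAt_flipAt i

/-- The relators `bᵢ²`, for `i = 1, …, n`. -/
def relators (n : ℕ) : Set (FreeGroup (Fin n)) :=
  Set.range fun i => FreeGroup.of i ^ 2

/-- The group `Γₙ = ⟨b₁, …, bₙ | b₁² = ⋯ = bₙ² = 1⟩`. -/
abbrev Gam (n : ℕ) : Type := PresentedGroup (relators n)

/-- The generator `bᵢ` of `Γₙ`. -/
def gen {n : ℕ} (i : Fin n) : Gam n := PresentedGroup.of i

theorem gen_mul_self {n : ℕ} (i : Fin n) : gen i * gen i = 1 := by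
  have h : PresentedGroup.mk (relators n) (FreeGroup.of i ^ 2) = 1 :=
    PresentedGroup.one_of_mem ⟨i, rfl⟩
  rw [pow_two, map_mul] at h
  exact h

theorem gen_inv {n : ℕ} (i : Fin n) : (gen i)⁻¹ = gen i :=
  inv_eq_of_mul_eq_one_left (gen_mul_self i)

theorem gen_ne_one {n : ℕ} (i : Fin n) : gen i ≠ 1 := by
  have hr : ∀ r ∈ relators n,
      FreeGroup.lift (fun _ : Fin n => Multiplicative.ofAdd (1 : ZMod 2)) r = 1 := by
    rintro _ ⟨j, rfl⟩
    simp only [map_pow, FreeGroup.lift_apply_of]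
    decide
  intro h
  have h2 : PresentedGroup.toGroup hr (gen i) = 1 := by rw [h, map_one]
  have h3 : PresentedGroup.toGroup hr (gen i) = Multiplicative.ofAdd (1 : ZMod 2) :=
    PresentedGroup.toGroup.of hr
  exact absurd (h3.symm.trans h2) (by decide)

/-- The action of `Γₙ` on `ℂⁿ`, in which `bᵢ` acts as `flipAt i`. -/
def act (n : ℕ) : Gam n →* Equiv.Perm (Fin n → ℂ) :=
  PresentedGroup.toGroup (f := flipPerm) (by
    rintro _ ⟨i, rfl⟩
    rw [map_pow, FreeGroup.lift_apply_of, pow_two]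
    ext1 x
    exact flipAt_flipAt i x)

theorem act_gen {n : ℕ} (i : Fin n) (x : Fin n → ℂ) : act n (gen i) x = flipAt i x := by
  simp only [act, gen, PresentedGroup.toGroup.of]
  rfl

/-- The graph on the vertex set `Γₙ` whose edges are the edges of the Cayley tree of `Γₙ` with
label in `I`: the vertices `g` and `h` are joined by an `i`-edge iff `g = h bᵢ`. For `I` the
set of all labels it is the Cayley tree itself. -/
def colorGraph {n : ℕ} (I : Finset (Fin n)) : SimpleGraph (Gam n) where
  Adj g h := ∃ i ∈ I, g = h * gen i
  symm := ⟨by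
    rintro g h ⟨i, hi, rfl⟩
    exact ⟨i, hi, by rw [mul_assoc, gen_mul_self, mul_one]⟩⟩
  loopless := ⟨by
    rintro g ⟨i, -, hi⟩
    exact gen_ne_one i (left_eq_mul.mp hi)⟩

/-- The set of alternating geodesics of the Cayley tree: an alternating geodesic consists of a
set `I = {i, j}` of two labels and a connected component of the graph formed by all vertices
and the edges labelled `i` or `j`. -/
abbrev AltGeod (n : ℕ) : Type :=
  Σ I : {I : Finset (Fin n) // I.card = 2}, (colorGraph I.1).ConnectedComponent

/-- The vector-valued Hurwitz map `g ↦ g⁻¹(a)` on the vertices of the Cayley tree. -/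
def orbitMap {n : ℕ} (a : Fin n → ℂ) (g : Gam n) : Fin n → ℂ := act n g⁻¹ a

/-- Along edges with labels in `I`, the coordinates outside `I` do not change. -/
theorem orbitMap_eq_of_walk {n : ℕ} (a : Fin n → ℂ) (I : Finset (Fin n)) {g h : Gam n}
    (p : (colorGraph I).Walk g h) {k : Fin n} (hk : k ∉ I) :
    orbitMap a g k = orbitMap a h k := by
  induction p with
  | nil => rfl
  | @cons u v w huv p ih =>
    rw [← ih]
    obtain ⟨i, hi, rfl⟩ := huv
    have hki : k ≠ i := fun h => hk (h ▸ hi)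
    simp only [orbitMap, mul_inv_rev, gen_inv, map_mul, Equiv.Perm.mul_apply, act_gen]
    simp [flipAt, Function.update_of_ne hki]

/-- The extended Hurwitz map: `φ(γ)` is the product of `x_k` over `k ≠ i, j`, for an alternating
`{i, j}`-geodesic `γ` and the vector `x` at any vertex of `γ`. -/
def phi {n : ℕ} (a : Fin n → ℂ) (γ : AltGeod n) : ℂ :=
  γ.2.lift (fun g => ∏ k ∈ γ.1.1ᶜ, orbitMap a g k) fun _ _ p _ =>
    Finset.prod_congr rfl fun _ hk => orbitMap_eq_of_walk a _ p (Finset.mem_compl.mp hk)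

/-- The square sum weight: `σ(γ)` is the sum of `x_k²` over `k ≠ i, j`, for an alternating
`{i, j}`-geodesic `γ` and the vector `x` at any vertex of `γ`. -/
def sigma {n : ℕ} (a : Fin n → ℂ) (γ : AltGeod n) : ℂ :=
  γ.2.lift (fun g => ∑ k ∈ γ.1.1ᶜ, orbitMap a g k ^ 2) fun _ _ p _ =>
    Finset.sum_congr rfl fun _ hk => by
      rw [orbitMap_eq_of_walk a _ p (Finset.mem_compl.mp hk)]

/-- The set `𝒟` of the `a ∈ ℂⁿ` such that `φ` takes no value in the real segment `[-2, 2]`, and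
for some `K > 2` there are only finitely many alternating geodesics with `|φ(γ)| ≤ K`. -/
def domainD (n : ℕ) : Set (Fin n → ℂ) :=
  {a | (∀ γ : AltGeod n, phi a γ ∉ Complex.ofReal '' Set.Icc (-2) 2) ∧
    ∃ K : ℝ, 2 < K ∧ {γ : AltGeod n | ‖phi a γ‖ ≤ K}.Finite}

/-- The square root with non-negative real part (the principal branch). -/
noncomputable def csqrt (z : ℂ) : ℂ := z ^ (1 / 2 : ℂ)

theorem csqrt_sq (z : ℂ) : csqrt z ^ 2 = z := by
  rw [csqrt, one_div]
  exact Complex.cpow_nat_inv_pow z two_ne_zero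

theorem csqrt_re_nonneg (z : ℂ) : 0 ≤ (csqrt z).re := by
  rcases eq_or_ne z 0 with rfl | hz
  · simp [csqrt]
  · rw [csqrt, Complex.cpow_def_of_ne_zero hz, Complex.exp_re]
    have him : (Complex.log z * (1 / 2 : ℂ)).im = z.arg / 2 := by
      rw [show (1 / 2 : ℂ) = ((1 / 2 : ℝ) : ℂ) by norm_num, Complex.im_mul_ofReal,
        Complex.log_im]
      ring
    rw [him]
    have h1 := Complex.neg_pi_lt_arg z
    have h2 := Complex.arg_le_pi z
    exact mul_nonneg (Real.exp_pos _).le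
      (Real.cos_nonneg_of_neg_pi_div_two_le_of_le (by linarith) (by linarith))

/-- `h(z) = 1 - √(1 - 4 / z²)`. -/
noncomputable def hfun (z : ℂ) : ℂ := 1 - csqrt (1 - 4 / z ^ 2)

/-- The summand `1 - (1 + 2μ / (n(n-1)(σ(γ) - μ))) √(1 - 4 / φ(γ)²)`. -/
noncomputable def hmu {n : ℕ} (μ : ℂ) (a : Fin n → ℂ) (γ : AltGeod n) : ℂ :=
  1 - (1 + 2 * μ / ((n : ℂ) * ((n : ℂ) - 1) * (sigma a γ - μ))) *
    csqrt (1 - 4 / phi a γ ^ 2)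

end MarkoffHurwitz

/-! Write x for the vector at a vertex and S for the sum of 1/(x₁⋯xₙ) over all vertices of the tree.
The theorem is the difference of two evaluations, ∑ h(φ) = 1 + μS (`Tame.hasSum_hfun`) and ∑ √(1 -
4/φ²)/(σ - μ) = n(n-1)S/2 (`Tame.hasSum_csqrt_div`): 𝔥_μ is the first summand minus 2μ/(n(n-1))
times the second, so S cancels.

Along a geodesic the two moving coordinates satisfy a linear recurrence with eigenvalues λ, λ⁻¹,
where λ + λ⁻¹ = φ and |λ| > 1. Hence the sum of 1/∏x over the vertices of γ has the closed form √(1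
- 4/φ²)/(σ - μ) (`total_eq`). Each vertex lies on n(n-1)/2 geodesics, which gives the second
evaluation.

For the first, the directed edge leaving x with label i gets the weight x_i²/∏x. The two directions
of an edge have total weight 1, and the weights leaving a vertex have total 1 + μ/∏x; so the weights
leaving a ball sum to 1 + μ∑1/∏x over that ball (`sum_sq_edges`). A geodesic rooted inside the ball
leaves it at two ends, and half of h(φ) is assigned to each end. Half of h(φ) differs from the edge
weight by (σ - μ) times a tail of the vertex sum (`sq_mul_sub_halfTerm`), and these errors vanish in
the limit.

Convergence rests on growth: outside a finite ball the coordinate changed last exceeds all others by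
a fixed factor ρ > 1 (`Tame.eventuallyGrowing`). If not, compactness gives an infinite ray without
growth. By finiteness of {|φ| ≤ K}, it is eventually alternating, where the λ-component is non-zero
and forces growth, or all φ at its last edge eventually exceed K, where an ascent persists forever
and perpetual descent would make all coordinates small. Growth makes |∏x|^(-1/3) summable over the
tree (`Grows.summable_weight`), and this weight dominates all the terms. -/

namespace MarkoffHurwitz

/-! ### Reduced words -/

/-- The element of `Γₙ` spelled by a list of labels, the head of the list being the last letter. -/
def wordVal {n : ℕ} : List (Fin n) → Gam n
  | [] => 1
  | i :: l => wordVal l * gen i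

/-- The vector at the end of the path that starts at `a` and has the labels of the list. -/
def pathVec {n : ℕ} (a : Fin n → ℂ) (l : List (Fin n)) : Fin n → ℂ := l.foldr flipAt a

theorem pathVec_cons {n : ℕ} (a : Fin n → ℂ) (i : Fin n) (l : List (Fin n)) :
    pathVec a (i :: l) = flipAt i (pathVec a l) := rfl

theorem orbitMap_mul_gen {n : ℕ} (a : Fin n → ℂ) (g : Gam n) (i : Fin n) :
    orbitMap a (g * gen i) = flipAt i (orbitMap a g) := by
  simp only [orbitMap, mul_inv_rev, gen_inv, map_mul, Equiv.Perm.mul_apply, act_gen]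

theorem orbitMap_wordVal {n : ℕ} (a : Fin n → ℂ) (l : List (Fin n)) :
    orbitMap a (wordVal l) = pathVec a l := by
  induction l with
  | nil => simp [wordVal, orbitMap, pathVec]
  | cons i l ih => rw [wordVal, orbitMap_mul_gen, ih, pathVec_cons]

/-- A list of labels is reduced if consecutive labels differ. -/
abbrev Reduced {n : ℕ} (l : List (Fin n)) : Prop := l.IsChain (· ≠ ·)

/-- Right multiplication by the generator `bᵢ`, on reduced words. -/
def toggle {n : ℕ} (i : Fin n) (l : List (Fin n)) : List (Fin n) :=
  if l.head? = some i then l.tail else i :: l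

theorem Reduced.toggle {n : ℕ} (i : Fin n) {l : List (Fin n)} (h : Reduced l) :
    Reduced (toggle i l) := by
  unfold MarkoffHurwitz.toggle
  split_ifs with hi
  · exact h.tail
  · rw [Reduced, List.isChain_cons]
    refine ⟨fun y hy e => hi ?_, h⟩
    subst e; exact hy

/-- Reducedness excludes a leading `i, i`, where the second toggle would delete again instead of
restoring. -/
theorem toggle_toggle {n : ℕ} (i : Fin n) {l : List (Fin n)} (h : Reduced l) :
    toggle i (toggle i l) = l := by
  cases l with
  | nil => simp [toggle]
  | cons j l =>
    by_cases hj : j = i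
    · subst hj
      have : l.head? ≠ some j := by
        intro e
        rw [Reduced, List.isChain_cons] at h
        exact h.1 j e rfl
      simp [toggle, this]
    · simp [toggle, hj]

theorem wordVal_toggle {n : ℕ} (i : Fin n) (l : List (Fin n)) :
    wordVal (toggle i l) = wordVal l * gen i := by
  cases l with
  | nil => simp [toggle, wordVal]
  | cons j l =>
    by_cases hj : j = i
    · subst hj
      simp [toggle, wordVal, mul_assoc, gen_mul_self]
    · simp [toggle, hj, wordVal]

/-- `toggle i` as a permutation of the reduced words. -/
def togglePerm {n : ℕ} (i : Fin n) : Equiv.Perm {l : List (Fin n) // Reduced l} where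
  toFun l := ⟨toggle i l.1, l.2.toggle i⟩
  invFun l := ⟨toggle i l.1, l.2.toggle i⟩
  left_inv l := Subtype.ext (toggle_toggle i l.2)
  right_inv l := Subtype.ext (toggle_toggle i l.2)

/-- The action of `Γₙ` on the reduced words. -/
def wordAct (n : ℕ) : Gam n →* Equiv.Perm {l : List (Fin n) // Reduced l} :=
  PresentedGroup.toGroup (f := togglePerm) (by
    rintro _ ⟨i, rfl⟩
    rw [map_pow, FreeGroup.lift_apply_of, pow_two]
    ext1 x
    exact Subtype.ext (toggle_toggle i x.2))

theorem wordAct_gen {n : ℕ} (i : Fin n) : wordAct n (gen i) = togglePerm i := by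
  simp only [wordAct, gen, PresentedGroup.toGroup.of]

/-- The reduced word of an element of `Γₙ`. -/
def normalForm {n : ℕ} (g : Gam n) : {l : List (Fin n) // Reduced l} :=
  wordAct n g⁻¹ ⟨[], List.IsChain.nil⟩

theorem normalForm_mul_gen {n : ℕ} (g : Gam n) (i : Fin n) :
    (normalForm (g * gen i)).1 = toggle i (normalForm g).1 := by
  simp only [normalForm, mul_inv_rev, gen_inv, map_mul, Equiv.Perm.mul_apply, wordAct_gen]
  rfl

theorem normalForm_wordVal {n : ℕ} {l : List (Fin n)} (h : Reduced l) :
    (normalForm (wordVal l)).1 = l := by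
  induction l with
  | nil => simp [normalForm, wordVal]
  | cons i l ih =>
    rw [Reduced, List.isChain_cons] at h
    rw [wordVal, normalForm_mul_gen, ih h.2, toggle, if_neg]
    exact fun e => h.1 i e rfl

/-- Van der Waerden's argument: the action on reduced words lifts right multiplication, so
evaluating it at the empty word inverts `wordVal` and makes reduced words a normal form. -/
theorem wordVal_wordAct {n : ℕ} (g : Gam n) (l : {l : List (Fin n) // Reduced l}) :
    wordVal (wordAct n g l).1 = wordVal l.1 * g⁻¹ := by
  have hg : g ∈ Subgroup.closure (Set.range (PresentedGroup.of (rels := relators n))) := by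
    rw [PresentedGroup.closure_range_of]; trivial
  induction hg using Subgroup.closure_induction generalizing l with
  | mem x hx =>
    obtain ⟨i, rfl⟩ := hx
    change wordVal (wordAct n (gen i) l).1 = wordVal l.1 * (gen i)⁻¹
    rw [wordAct_gen, gen_inv]
    exact wordVal_toggle i l.1
  | one => simp
  | mul x y _ _ hx hy =>
    rw [map_mul, Equiv.Perm.mul_apply, hx, hy, mul_inv_rev, mul_assoc]
  | inv x _ hx =>
    have := hx (wordAct n x⁻¹ l)
    rw [← Equiv.Perm.mul_apply, ← map_mul, mul_inv_cancel, map_one, Equiv.Perm.one_apply] at this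
    rw [this]; simp

theorem wordVal_normalForm {n : ℕ} (g : Gam n) : wordVal (normalForm g).1 = g := by
  rw [normalForm, wordVal_wordAct]; simp [wordVal]

/-! ### Alternating geodesics and their initial words -/

/-- A step along an `I`-edge only alters the leading block of letters in `I`; the rest of the word
is therefore an invariant of the geodesic. -/
theorem dropWhile_toggle {n : ℕ} (I : Finset (Fin n)) {i : Fin n} (hi : i ∈ I)
    (l : List (Fin n)) :
    (toggle i l).dropWhile (· ∈ I) = l.dropWhile (· ∈ I) := by
  unfold toggle
  split_ifs with h
  · cases l with
    | nil => rfl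
    | cons j l =>
      simp only [List.head?_cons, Option.some.injEq] at h
      subst h
      simp [hi]
  · simp [hi]

/-- The shortest word of an alternating geodesic. -/
def rootWord {n : ℕ} (γ : AltGeod n) : List (Fin n) :=
  γ.2.lift (fun g => (normalForm g).1.dropWhile (· ∈ γ.1.1)) fun g h p _ => by
    induction p with
    | nil => rfl
    | cons huv p ih =>
      rw [← ih (SimpleGraph.Walk.IsPath.of_cons ‹_›)]
      obtain ⟨i, hi, rfl⟩ := huv
      rw [normalForm_mul_gen, dropWhile_toggle _ hi]

/-- The alternating geodesic with labels in `I` through the vertex of a word. -/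
def geodAt {n : ℕ} (I : {I : Finset (Fin n) // I.card = 2}) (l : List (Fin n)) : AltGeod n :=
  ⟨I, (colorGraph I.1).connectedComponentMk (wordVal l)⟩

theorem rootWord_geodAt {n : ℕ} (I : {I : Finset (Fin n) // I.card = 2}) {l : List (Fin n)}
    (h : Reduced l) : rootWord (geodAt I l) = l.dropWhile (· ∈ I.1) := by
  change (normalForm (wordVal l)).1.dropWhile (· ∈ I.1) = _
  rw [normalForm_wordVal h]

theorem geodAt_cons {n : ℕ} (I : {I : Finset (Fin n) // I.card = 2}) {i : Fin n} (hi : i ∈ I.1)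
    (l : List (Fin n)) : geodAt I (i :: l) = geodAt I l := by
  unfold geodAt
  congr 1
  exact SimpleGraph.ConnectedComponent.sound (SimpleGraph.Adj.reachable ⟨i, hi, rfl⟩)

theorem geodAt_dropWhile {n : ℕ} (I : {I : Finset (Fin n) // I.card = 2}) (l : List (Fin n)) :
    geodAt I (l.dropWhile (· ∈ I.1)) = geodAt I l := by
  induction l with
  | nil => rfl
  | cons i l ih =>
    by_cases hi : i ∈ I.1
    · rw [geodAt_cons I hi, ← ih, List.dropWhile_cons_of_pos (by simpa using hi)]
    · rw [List.dropWhile_cons_of_neg (by simpa using hi)]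

/-- Pairs of labels with a reduced word whose last label is not in the pair. -/
abbrev Root (n : ℕ) : Type :=
  {p : {I : Finset (Fin n) // I.card = 2} × {l : List (Fin n) // Reduced l} //
    ∀ k ∈ p.2.1.head?, k ∉ p.1.1}

theorem reduced_rootWord {n : ℕ} (γ : AltGeod n) : Reduced (rootWord γ) := by
  obtain ⟨I, c⟩ := γ
  induction c using SimpleGraph.ConnectedComponent.ind with
  | h g => exact (normalForm g).2.suffix (List.dropWhile_suffix _)

theorem head_rootWord {n : ℕ} (γ : AltGeod n) : ∀ k ∈ (rootWord γ).head?, k ∉ γ.1.1 := by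
  obtain ⟨I, c⟩ := γ
  induction c using SimpleGraph.ConnectedComponent.ind with
  | h g =>
    intro k hk
    have := List.head?_dropWhile_not (fun x => decide (x ∈ I.1)) (normalForm g).1
    change k ∈ ((normalForm g).1.dropWhile (· ∈ I.1)).head? at hk
    rw [Option.mem_def] at hk
    rw [hk] at this
    simpa using this

/-- Alternating geodesics correspond to their shortest words. -/
def geodEquiv (n : ℕ) : AltGeod n ≃ Root n where
  toFun γ := ⟨(γ.1, ⟨rootWord γ, reduced_rootWord γ⟩), head_rootWord γ⟩
  invFun r := geodAt r.1.1 r.1.2.1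
  left_inv γ := by
    obtain ⟨I, c⟩ := γ
    induction c using SimpleGraph.ConnectedComponent.ind with
    | h g =>
      change geodAt I ((normalForm g).1.dropWhile (· ∈ I.1)) = _
      rw [geodAt_dropWhile, geodAt, wordVal_normalForm]
  right_inv r := by
    obtain ⟨⟨I, l, hl⟩, h⟩ := r
    have : l.dropWhile (· ∈ I.1) = l := by
      cases l with
      | nil => rfl
      | cons i l => rw [List.dropWhile_cons_of_neg]; simpa using h i rfl
    ext1
    refine Prod.ext rfl (Subtype.ext ?_)
    change rootWord (geodAt I l) = l
    rw [rootWord_geodAt I hl, this]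

theorem phi_geodAt {n : ℕ} (a : Fin n → ℂ) (I : {I : Finset (Fin n) // I.card = 2})
    (l : List (Fin n)) : phi a (geodAt I l) = ∏ k ∈ I.1ᶜ, pathVec a l k := by
  rw [← orbitMap_wordVal]; rfl

theorem sigma_geodAt {n : ℕ} (a : Fin n → ℂ) (I : {I : Finset (Fin n) // I.card = 2})
    (l : List (Fin n)) : sigma a (geodAt I l) = ∑ k ∈ I.1ᶜ, pathVec a l k ^ 2 := by
  rw [← orbitMap_wordVal]; rfl

/-! ### The root of largest modulus of `λ + λ⁻¹ = φ` -/

/-- The solution `λ` of `λ + λ⁻¹ = φ` with `1 < |λ|`, for `φ ∉ [-2, 2]`. -/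
noncomputable def bigRoot (φ : ℂ) : ℂ := φ * (1 + csqrt (1 - 4 / φ ^ 2)) / 2

/-- The real segment `[-2, 2]` in the complex plane. -/
def seg : Set ℂ := Complex.ofReal '' Set.Icc (-2) 2

theorem ne_zero_of_notMem_seg {φ : ℂ} (h : φ ∉ seg) : φ ≠ 0 := by
  rintro rfl
  exact h ⟨0, by norm_num, by simp⟩

/-- A purely imaginary root `it` would give φ²(1 + t²) = 4, so φ = ±2/√(1 + t²) would lie in the
segment. -/
theorem csqrt_re_pos {φ : ℂ} (h : φ ∉ seg) : 0 < (csqrt (1 - 4 / φ ^ 2)).re := by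
  refine lt_of_le_of_ne (csqrt_re_nonneg _) fun h0 => h ?_
  have hφ := ne_zero_of_notMem_seg h
  set s := csqrt (1 - 4 / φ ^ 2) with hs
  have h2 : s ^ 2 = 1 - 4 / φ ^ 2 := csqrt_sq _
  have h3 : s ^ 2 = ((-(s.im ^ 2) : ℝ) : ℂ) := by
    apply Complex.ext
    · simp [pow_two, ← h0]
    · simp [pow_two, ← h0]
  have h4 : φ ^ 2 * ((1 + s.im ^ 2 : ℝ) : ℂ) = 4 := by
    have : ((1 + s.im ^ 2 : ℝ) : ℂ) = 4 / φ ^ 2 := by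
      have e : (1 : ℂ) - s ^ 2 = 4 / φ ^ 2 := by rw [h2]; ring
      rw [← e, h3]; push_cast; ring
    rw [this]; field_simp
  have hp : 0 < 1 + s.im ^ 2 := by positivity
  set r : ℝ := 2 / Real.sqrt (1 + s.im ^ 2) with hr
  have hsq : 1 ≤ Real.sqrt (1 + s.im ^ 2) := by
    rw [Real.one_le_sqrt]; nlinarith [sq_nonneg s.im]
  have hr2 : r ^ 2 * (1 + s.im ^ 2) = 4 := by
    rw [hr, div_pow, Real.sq_sqrt hp.le]; field_simp; norm_num
  have hr0 : 0 ≤ r := by positivity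
  have hrle : r ≤ 2 := by rw [hr]; exact div_le_self (by norm_num) hsq
  have h5 : φ ^ 2 = (r : ℂ) ^ 2 := by
    have e : (r : ℂ) ^ 2 * ((1 + s.im ^ 2 : ℝ) : ℂ) = 4 := by exact_mod_cast hr2
    exact mul_right_cancel₀ (by exact_mod_cast hp.ne') (h4.trans e.symm)
  rcases sq_eq_sq_iff_eq_or_eq_neg.mp h5 with e | e
  · exact ⟨r, ⟨by linarith, hrle⟩, e.symm⟩
  · exact ⟨-r, ⟨by linarith, by linarith⟩, by rw [e]; push_cast; ring⟩

theorem bigRoot_mul {φ : ℂ} (h : φ ≠ 0) :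
    bigRoot φ * (φ * (1 - csqrt (1 - 4 / φ ^ 2)) / 2) = 1 := by
  have h2 := csqrt_sq (1 - 4 / φ ^ 2)
  have : bigRoot φ * (φ * (1 - csqrt (1 - 4 / φ ^ 2)) / 2)
      = φ ^ 2 * (1 - csqrt (1 - 4 / φ ^ 2) ^ 2) / 4 := by unfold bigRoot; ring
  rw [this, h2]; field_simp; ring

theorem bigRoot_inv {φ : ℂ} (h : φ ≠ 0) :
    (bigRoot φ)⁻¹ = φ * (1 - csqrt (1 - 4 / φ ^ 2)) / 2 :=
  inv_eq_of_mul_eq_one_right (bigRoot_mul h)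

theorem bigRoot_ne_zero {φ : ℂ} (h : φ ≠ 0) : bigRoot φ ≠ 0 :=
  left_ne_zero_of_mul_eq_one (bigRoot_mul h)

theorem bigRoot_add_inv {φ : ℂ} (h : φ ≠ 0) : bigRoot φ + (bigRoot φ)⁻¹ = φ := by
  rw [bigRoot_inv h, bigRoot]; ring

/-- The roots φ(1 ± s)/2 have product 1, and Re s > 0 makes |1 + s| > |1 - s|. -/
theorem one_lt_norm_bigRoot {φ : ℂ} (h : φ ∉ seg) : 1 < ‖bigRoot φ‖ := by
  have hφ := ne_zero_of_notMem_seg h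
  have hpos := csqrt_re_pos h
  have hlt : ‖(bigRoot φ)⁻¹‖ < ‖bigRoot φ‖ := by
    rw [bigRoot_inv hφ, bigRoot]
    set s := csqrt (1 - 4 / φ ^ 2)
    have : ‖1 - s‖ < ‖1 + s‖ := by
      refine lt_of_pow_lt_pow_left₀ 2 (norm_nonneg _) ?_
      rw [← Complex.normSq_eq_norm_sq, ← Complex.normSq_eq_norm_sq, Complex.normSq_apply,
        Complex.normSq_apply]
      simp only [Complex.sub_re, Complex.one_re, Complex.sub_im, Complex.one_im, Complex.add_re,
        Complex.add_im]
      nlinarith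
    rw [norm_div, norm_div, norm_mul, norm_mul]
    have := norm_pos_iff.mpr hφ
    gcongr
    simp
  rw [norm_inv] at hlt
  by_contra hle
  push Not at hle
  have h0 : 0 < ‖bigRoot φ‖ := norm_pos_iff.mpr (bigRoot_ne_zero hφ)
  have := one_le_inv_iff₀.mpr ⟨h0, hle⟩
  linarith

theorem csqrt_eq_bigRoot {φ : ℂ} (h : φ ≠ 0) :
    csqrt (1 - 4 / φ ^ 2) = (bigRoot φ - (bigRoot φ)⁻¹) / φ := by
  rw [bigRoot_inv h, bigRoot]; field_simp; ring

theorem hfun_eq_bigRoot {φ : ℂ} (h : φ ≠ 0) : hfun φ = 2 * ((bigRoot φ)⁻¹ / φ) := by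
  rw [bigRoot_inv h, hfun]; field_simp

theorem norm_bigRoot_inv_le {φ : ℂ} (h : φ ∉ seg) : ‖(bigRoot φ)⁻¹‖ ≤ 2 / ‖φ‖ := by
  have hφ := ne_zero_of_notMem_seg h
  have h1 := one_lt_norm_bigRoot h
  have h0 : 0 < ‖φ‖ := norm_pos_iff.mpr hφ
  have h2 : ‖φ‖ ≤ 2 * ‖bigRoot φ‖ := by
    calc ‖φ‖ = ‖bigRoot φ + (bigRoot φ)⁻¹‖ := by rw [bigRoot_add_inv hφ]
      _ ≤ ‖bigRoot φ‖ + ‖(bigRoot φ)⁻¹‖ := norm_add_le _ _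
      _ ≤ 2 * ‖bigRoot φ‖ := by
        rw [norm_inv]
        have := inv_le_one_of_one_le₀ h1.le
        linarith
  rw [norm_inv, le_div_iff₀ h0, inv_mul_le_iff₀ (by linarith)]
  linarith

/-! ### Flips -/

section Flips

variable {n : ℕ}

/-- The product of the coordinates other than the `i`-th and the `j`-th. -/
def coProd (x : Fin n → ℂ) (i j : Fin n) : ℂ := ∏ k ∈ ({i, j} : Finset (Fin n))ᶜ, x k

theorem coProd_comm (x : Fin n → ℂ) (i j : Fin n) : coProd x i j = coProd x j i := by
  rw [coProd, coProd, Finset.pair_comm]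

theorem flipAt_ne (x : Fin n → ℂ) {i k : Fin n} (h : k ≠ i) : flipAt i x k = x k := by
  simp [flipAt, h]

theorem coProd_flipAt (x : Fin n → ℂ) (i j : Fin n) :
    coProd (flipAt i x) i j = coProd x i j := by
  refine Finset.prod_congr rfl fun k hk => flipAt_ne x ?_
  rintro rfl
  simp at hk

theorem prod_erase_eq (x : Fin n → ℂ) {i j : Fin n} (h : i ≠ j) :
    ∏ k ∈ Finset.univ.erase i, x k = coProd x i j * x j := by
  have : Finset.univ.erase i = insert j ({i, j} : Finset (Fin n))ᶜ := by
    ext k; simp; grind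
  rw [this, Finset.prod_insert (by simp), coProd, mul_comm]

theorem flipAt_self (x : Fin n → ℂ) {i j : Fin n} (h : i ≠ j) :
    flipAt i x i = coProd x i j * x j - x i := by
  rw [← prod_erase_eq x h]; simp [flipAt]

theorem prod_eq_coProd (x : Fin n → ℂ) {i j : Fin n} (h : i ≠ j) :
    ∏ k, x k = coProd x i j * x i * x j := by
  rw [← Finset.mul_prod_erase _ _ (Finset.mem_univ i), prod_erase_eq x h]; ring

theorem coProd_mul_eq (x : Fin n → ℂ) {i j k : Fin n} (hij : i ≠ j) (hik : i ≠ k) :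
    coProd x i j * x j = coProd x i k * x k := by
  rw [← prod_erase_eq x hij, ← prod_erase_eq x hik]

theorem sum_sq_eq (x : Fin n → ℂ) {i j : Fin n} (h : i ≠ j) :
    ∑ k, x k ^ 2 = ∑ k ∈ ({i, j} : Finset (Fin n))ᶜ, x k ^ 2 + (x i ^ 2 + x j ^ 2) := by
  rw [← Finset.sum_compl_add_sum ({i, j} : Finset (Fin n)), Finset.sum_pair h]

/-- As a polynomial in x_i this is a monic quadratic, and the flip replaces x_i by the other point
with the same value. -/
theorem hurwitzPoly_flipAt (hn : 2 ≤ n) (i : Fin n) (x : Fin n → ℂ) :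
    hurwitzPoly (flipAt i x) = hurwitzPoly x := by
  obtain ⟨j, hj⟩ : ∃ j : Fin n, j ≠ i := by
    have : Nontrivial (Fin n) := Fin.nontrivial_iff_two_le.mpr hn
    exact exists_ne i
  have hs : ∑ k ∈ ({i, j} : Finset (Fin n))ᶜ, flipAt i x k ^ 2
      = ∑ k ∈ ({i, j} : Finset (Fin n))ᶜ, x k ^ 2 :=
    Finset.sum_congr rfl fun k hk => by
      rw [flipAt_ne]; rintro rfl; simp at hk
  rw [hurwitzPoly, hurwitzPoly, sum_sq_eq _ hj.symm, sum_sq_eq x hj.symm, prod_eq_coProd _ hj.symm,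
    prod_eq_coProd x hj.symm, hs, coProd_flipAt, flipAt_self x hj.symm, flipAt_ne x hj]
  ring

theorem hurwitzPoly_pathVec (hn : 2 ≤ n) (a : Fin n → ℂ) (l : List (Fin n)) :
    hurwitzPoly (pathVec a l) = hurwitzPoly a := by
  induction l with
  | nil => rfl
  | cons i l ih => rw [pathVec_cons, hurwitzPoly_flipAt hn, ih]

theorem exists_third (hn : 3 ≤ n) (i j : Fin n) : ∃ k : Fin n, k ≠ i ∧ k ≠ j := by
  obtain ⟨k, -, hk⟩ := Finset.exists_mem_notMem_of_card_lt_card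
    (s := ({i, j} : Finset (Fin n))) (t := Finset.univ)
    (lt_of_le_of_lt Finset.card_le_two (by rw [Finset.card_univ, Fintype.card_fin]; omega))
  exact ⟨k, by simpa using hk⟩

theorem ne_zero_of_coProd (hn : 3 ≤ n) {x : Fin n → ℂ}
    (h : ∀ i j, i ≠ j → coProd x i j ≠ 0) (k : Fin n) : x k ≠ 0 := by
  obtain ⟨i, hi, -⟩ := exists_third hn k k
  obtain ⟨j, hj, hji⟩ := exists_third hn k i
  exact Finset.prod_ne_zero_iff.mp (h i j hji.symm) k (by simp [hi.symm, hj.symm])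

/-! ### Paths with prescribed labels -/

/-- The words obtained from `l` by successively adding the letters of a sequence. -/
def extendBy (c : ℕ → Fin n) (l : List (Fin n)) : ℕ → List (Fin n)
  | 0 => l
  | k + 1 => c k :: extendBy c l k

theorem extendBy_add (c : ℕ → Fin n) (l : List (Fin n)) (m k : ℕ) :
    extendBy c l (m + k) = extendBy (fun r => c (m + r)) (extendBy c l m) k := by
  induction k with
  | zero => rfl
  | succ k ih => rw [← add_assoc, extendBy, ih, extendBy]

theorem length_extendBy (c : ℕ → Fin n) (l : List (Fin n)) (k : ℕ) :
    (extendBy c l k).length = l.length + k := by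
  induction k with
  | zero => rfl
  | succ k ih => rw [extendBy, List.length_cons, ih]; ring

theorem eq_or_eq_of_periodic {c : ℕ → Fin n} (hc : ∀ k, c (k + 2) = c k)
    (k : ℕ) : (c k = c 0 ∧ c (k + 1) = c 1) ∨
    (c k = c 1 ∧ c (k + 1) = c 0) := by
  induction k with
  | zero => simp
  | succ k ih =>
    rcases ih with ⟨h1, h2⟩ | ⟨h1, h2⟩
    · right; exact ⟨h2, by rw [hc, h1]⟩
    · left; exact ⟨h2, by rw [hc, h1]⟩

theorem pathVec_extendBy_ne {c : ℕ → Fin n} (hc : ∀ k, c (k + 2) = c k)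
    (a : Fin n → ℂ) (l : List (Fin n)) {m : Fin n} (h0 : m ≠ c 0)
    (h1 : m ≠ c 1) (k : ℕ) : pathVec a (extendBy c l k) m = pathVec a l m := by
  induction k with
  | zero => rfl
  | succ k ih =>
    rw [extendBy, pathVec_cons, flipAt_ne, ih]
    rcases eq_or_eq_of_periodic hc k with ⟨h, -⟩ | ⟨h, -⟩ <;> rw [h] <;> assumption

theorem coProd_extendBy {c : ℕ → Fin n} (hc : ∀ k, c (k + 2) = c k)
    (a : Fin n → ℂ) (l : List (Fin n)) (k : ℕ) :
    coProd (pathVec a (extendBy c l k)) (c k) (c (k + 1)) = coProd (pathVec a l) (c 0) (c 1) := by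
  induction k with
  | zero => rfl
  | succ k ih => rw [hc, coProd_comm, extendBy, pathVec_cons, coProd_flipAt, ih]

theorem alternating_step {c : ℕ → Fin n} (hc : ∀ k, c (k + 2) = c k)
    (hne : ∀ k, c k ≠ c (k + 1)) (a : Fin n → ℂ) (l : List (Fin n)) (k : ℕ) :
    pathVec a (extendBy c l (k + 1)) (c (k + 1)) = pathVec a (extendBy c l k) (c (k + 1)) ∧
    pathVec a (extendBy c l (k + 1)) (c (k + 1 + 1)) = coProd (pathVec a l) (c 0) (c 1) *
      pathVec a (extendBy c l k) (c (k + 1)) - pathVec a (extendBy c l k) (c k) := by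
  rw [hc, extendBy, pathVec_cons, flipAt_ne _ (hne k).symm, flipAt_self _ (hne k),
    coProd_extendBy hc]
  exact ⟨rfl, rfl⟩

/-- The step (z, y) ↦ (y, φy - z) has the eigenforms by - z and y - bz, with eigenvalues b and b⁻¹.
-/
theorem alternating_closed {c : ℕ → Fin n} (hc : ∀ k, c (k + 2) = c k)
    (hne : ∀ k, c k ≠ c (k + 1))
    (a : Fin n → ℂ) (l : List (Fin n)) {b : ℂ} (hb : b ≠ 0)
    (hφ : b + b⁻¹ = coProd (pathVec a l) (c 0) (c 1)) (k : ℕ) :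
    b * pathVec a (extendBy c l k) (c (k + 1)) - pathVec a (extendBy c l k) (c k)
      = b ^ k * (b * pathVec a l (c 1) - pathVec a l (c 0)) ∧
    pathVec a (extendBy c l k) (c (k + 1)) - b * pathVec a (extendBy c l k) (c k)
      = b⁻¹ ^ k * (pathVec a l (c 1) - b * pathVec a l (c 0)) := by
  induction k with
  | zero => simp [extendBy]
  | succ k ih =>
    obtain ⟨e1, e2⟩ := alternating_step hc hne a l k
    rw [e1, e2, ← hφ, pow_succ', pow_succ', mul_assoc, mul_assoc, ← ih.1, ← ih.2]
    constructor <;> field_simp <;> ring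

end Flips

open Filter Topology

/-! ### Growth of the coordinates along reduced words -/

section Growth

variable {n : ℕ}

/-- The conditions on a vector that are used in the growth estimates, in terms of words. -/
structure Tame (a : Fin n → ℂ) (ε K : ℝ) : Prop where
  three_le : 3 ≤ n
  notMem_seg : ∀ l i j, i ≠ j → coProd (pathVec a l) i j ∉ seg
  pos : 0 < ε
  two_lt : 2 < K
  lower : ∀ l i j, i ≠ j → ε ≤ ‖coProd (pathVec a l) i j‖
  -- A reduced ray either ends up inside one geodesic, or from some point on every geodesic through
  -- its last edge has |φ| > K.
  ray : ∀ f : ℕ → Fin n, (∀ k, f k ≠ f (k + 1)) →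
    (∃ M, ∀ k, f (M + k + 2) = f (M + k)) ∨
    ∃ M, ∀ m ≥ M, ∀ i, i ≠ f m → K < ‖coProd (pathVec a (extendBy f [] (m + 1))) (f m) i‖

theorem Tame.coProd_ne_zero {a : Fin n → ℂ} {ε K : ℝ} (h : Tame a ε K) (l : List (Fin n))
    {i j : Fin n} (hij : i ≠ j) : coProd (pathVec a l) i j ≠ 0 :=
  ne_zero_of_notMem_seg (h.notMem_seg l i j hij)

theorem Tame.ne_zero {a : Fin n → ℂ} {ε K : ℝ} (h : Tame a ε K) (l : List (Fin n))
    (i : Fin n) : pathVec a l i ≠ 0 :=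
  ne_zero_of_coProd h.three_le (fun _ _ hij => h.coProd_ne_zero l hij) i

theorem bigRoot_sq_ne_one {φ : ℂ} (h : φ ∉ seg) : bigRoot φ ^ 2 - 1 ≠ 0 := by
  intro e
  have h1 := one_lt_norm_bigRoot h
  have h2 : ‖bigRoot φ‖ ^ 2 = 1 := by rw [← norm_pow, sub_eq_zero.mp e, norm_one]
  nlinarith

/-- Along an alternating path the coordinates have a non-zero growing component. -/
theorem Tame.growing_ne_zero {a : Fin n → ℂ} {ε K : ℝ} (h : Tame a ε K) (l : List (Fin n))
    {i j : Fin n} (hij : i ≠ j) :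
    bigRoot (coProd (pathVec a l) i j) * pathVec a l j - pathVec a l i ≠ 0 := by
  intro h0
  set c : ℕ → Fin n := fun k => if Even k then i else j with hcdef
  have hc : ∀ k, c (k + 2) = c k := fun k => by simp [hcdef, Nat.even_add]
  have hne : ∀ k, c k ≠ c (k + 1) := fun k => by
    by_cases hk : Even k
    · simp [hcdef, hk, Nat.even_add_one, hij]
    · simp [hcdef, hk, Nat.even_add_one, hij.symm]
  have c0 : c 0 = i := by simp [hcdef]
  have c1 : c 1 = j := by simp [hcdef]
  set φ := coProd (pathVec a l) i j with hφ
  have hseg : φ ∉ seg := h.notMem_seg l i j hij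
  set b := bigRoot φ with hb
  have hb0 : b ≠ 0 := bigRoot_ne_zero (ne_zero_of_notMem_seg hseg)
  have hb1 : 1 < ‖b‖ := one_lt_norm_bigRoot hseg
  obtain ⟨m, hmi, hmj⟩ := exists_third h.three_le i j
  -- Without the growing component the moving coordinates are pure multiples of b⁻ᵏ.
  have key : ∀ k, pathVec a (extendBy c l k) (c (k + 1)) =
      b⁻¹ ^ k * ((pathVec a l j - b * pathVec a l i) / (1 - b ^ 2)) := by
    intro k
    have hs : (1 : ℂ) - b ^ 2 ≠ 0 := by
      have := bigRoot_sq_ne_one hseg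
      intro e; apply this; linear_combination -e
    obtain ⟨e1, e2⟩ := alternating_closed hc hne a l hb0
      (by rw [c0, c1]; exact bigRoot_add_inv (ne_zero_of_notMem_seg hseg)) k
    rw [c0, c1] at e1 e2
    rw [h0, mul_zero] at e1
    rw [← mul_div_assoc, eq_div_iff hs, ← e2]
    linear_combination (-b) * e1
  -- A third coordinate x_m stays fixed, and coProd(c k, m) · x_m = φ · x_{c(k+1)}. The left side is
  -- bounded below through ε, while the right side decays.
  have hle : ∀ k, ε * ‖pathVec a l m‖ ≤
      ‖b‖⁻¹ ^ k * (‖φ‖ * ‖(pathVec a l j - b * pathVec a l i) / (1 - b ^ 2)‖) := by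
    intro k
    have hmc : c k ≠ m := by
      simp only [hcdef]; split_ifs; exacts [hmi.symm, hmj.symm]
    have e := coProd_mul_eq (pathVec a (extendBy c l k)) hmc (hne k)
    rw [coProd_extendBy hc, c0, c1, key k,
      pathVec_extendBy_ne hc a l (by rwa [c0]) (by rwa [c1])] at e
    calc ε * ‖pathVec a l m‖ ≤ ‖coProd (pathVec a (extendBy c l k)) (c k) m‖ * ‖pathVec a l m‖ := by
          gcongr; exact h.lower _ _ _ hmc
      _ = _ := by rw [← norm_mul, e, norm_mul, norm_mul, norm_pow, norm_inv]; ring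
  have hlim : Tendsto (fun k : ℕ => ‖b‖⁻¹ ^ k *
      (‖φ‖ * ‖(pathVec a l j - b * pathVec a l i) / (1 - b ^ 2)‖)) atTop (𝓝 (0 * _)) :=
    (tendsto_pow_atTop_nhds_zero_of_lt_one (by positivity) (inv_lt_one_of_one_lt₀ hb1)).mul_const _
  rw [zero_mul] at hlim
  have := ge_of_tendsto' hlim hle
  have h2 : 0 < ε * ‖pathVec a l m‖ := mul_pos h.pos (norm_pos_iff.mpr (h.ne_zero l m))
  linarith

/-- The `j`-th coordinate dominates the others, and its products are large. -/
def Dominant (ρ K : ℝ) (x : Fin n → ℂ) (j : Fin n) : Prop :=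
  ∀ i, i ≠ j → ρ * ‖x i‖ ≤ ‖x j‖ ∧ K ≤ ‖coProd x j i‖

/-- The new coordinate is coProd(i, j) x_j - x_i, of modulus at least (K - 1)|x_j|. The products
stay large because coProd(i, k) x_i = coProd(j, k) x_j with |x_i| ≤ |x_j|. -/
theorem Dominant.flip {ρ K : ℝ} (hρ : 1 ≤ ρ) (hK : ρ ≤ K - 1) {x : Fin n → ℂ}
    (hx : ∀ i, x i ≠ 0) {i j : Fin n} (h : Dominant ρ K x j) (hij : i ≠ j) :
    Dominant ρ K (flipAt i x) i := by
  have hle : ∀ k, ‖x k‖ ≤ ‖x j‖ := fun k => by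
    by_cases hk : k = j
    · rw [hk]
    · have := (h k hk).1
      nlinarith [norm_nonneg (x k)]
  have hbig : ρ * ‖x j‖ ≤ ‖flipAt i x i‖ := by
    rw [flipAt_self x hij]
    have h1 := norm_sub_norm_le (coProd x i j * x j) (x i)
    rw [norm_mul, coProd_comm] at h1
    have h2 : K * ‖x j‖ ≤ ‖coProd x j i‖ * ‖x j‖ := by gcongr; exact (h i hij).2
    have h3 := hle i
    have h4 : ρ * ‖x j‖ ≤ (K - 1) * ‖x j‖ := by gcongr
    rw [coProd_comm]
    linarith
  intro k hk
  refine ⟨?_, ?_⟩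
  · rw [flipAt_ne x hk]
    exact (mul_le_mul_of_nonneg_left (hle k) (by linarith)).trans hbig
  · rw [coProd_flipAt]
    by_cases hkj : k = j
    · rw [hkj, coProd_comm]; exact (h i hij).2
    · have e := coProd_mul_eq x hk hkj
      have e2 : ‖coProd x i k‖ * ‖x i‖ = ‖coProd x j k‖ * ‖x j‖ := by
        rw [← norm_mul, ← norm_mul, coProd_comm x i, coProd_comm x j, e]
      have hp : 0 < ‖x i‖ := norm_pos_iff.mpr (hx i)
      refine le_of_mul_le_mul_right ?_ hp
      rw [e2]
      have h5 := (h k hkj).2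
      have : 0 ≤ K := by linarith
      exact mul_le_mul h5 (hle i) hp.le (norm_nonneg _)

/-- In all sufficiently long reduced extensions of the word `l`, the coordinate of the last letter
dominates the other coordinates by a fixed factor. -/
def EventuallyGrowing (a : Fin n → ℂ) (l : List (Fin n)) : Prop :=
  ∃ ρ : ℝ, 1 < ρ ∧ ∃ N : ℕ, ∀ w j, Reduced (j :: w) → l <:+ w → N ≤ w.length →
    ∀ i, i ≠ j → ρ * ‖pathVec a (j :: w) i‖ ≤ ‖pathVec a (j :: w) j‖

theorem suffix_induction {α : Type*} {l : List α} {P : List α → Prop} (h0 : P l)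
    (hs : ∀ i w, l <:+ w → P w → P (i :: w)) (w : List α) (hw : l <:+ w) : P w := by
  obtain ⟨e, rfl⟩ := hw
  induction e with
  | nil => exact h0
  | cons i e ih => exact hs i _ ⟨e, rfl⟩ ih

theorem exists_cons_suffix {α : Type*} {l w : List α} (h : l <:+ w)
    (hl : l.length < w.length) : ∃ i, i :: l <:+ w := by
  obtain ⟨e, rfl⟩ := h
  rcases List.eq_nil_or_concat e with rfl | ⟨e', i, rfl⟩
  · simp at hl
  · exact ⟨i, e', by simp⟩

theorem EventuallyGrowing.of_cons (hn : 0 < n) {a : Fin n → ℂ} {l : List (Fin n)}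
    (h : ∀ i, EventuallyGrowing a (i :: l)) : EventuallyGrowing a l := by
  have : Nonempty (Fin n) := ⟨⟨0, hn⟩⟩
  choose ρ hρ N hN using h
  obtain ⟨i₀, hi₀⟩ := Finite.exists_min ρ
  -- The bound `l.length + 1` ensures that `w` properly extends `l`, so that some hypothesis `h i`
  -- applies.
  refine ⟨ρ i₀, hρ i₀, max (l.length + 1) (Finset.univ.sup N), fun w j hr hs hl i hi => ?_⟩
  obtain ⟨k, hk⟩ := exists_cons_suffix hs (by omega)
  have h1 : N k ≤ Finset.univ.sup N := Finset.le_sup (Finset.mem_univ k)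
  refine le_trans ?_ (hN k w j hr hk (by omega) i hi)
  gcongr
  exact hi₀ k

theorem Tame.eventuallyGrowing_of_dominant {a : Fin n → ℂ} {ε K : ℝ} (h : Tame a ε K)
    {ρ : ℝ} (hρ : 1 < ρ) (hK : ρ ≤ K - 1) {l : List (Fin n)} {j : Fin n}
    (hd : Dominant ρ K (pathVec a (j :: l)) j) : EventuallyGrowing a (j :: l) := by
  have key : ∀ w, (j :: l) <:+ w → Reduced w →
      ∃ i w', w = i :: w' ∧ Dominant ρ K (pathVec a (i :: w')) i := by
    refine suffix_induction (fun _ => ⟨j, l, rfl, hd⟩) fun i w _ ih hr => ?_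
    obtain ⟨k, w', rfl, hk⟩ := ih hr.tail
    refine ⟨i, _, rfl, hk.flip hρ.le hK (h.ne_zero _) ?_⟩
    rw [Reduced, List.isChain_cons] at hr
    exact hr.1 k rfl
  refine ⟨ρ, hρ, 0, fun w k hr hs _ i hi => ?_⟩
  obtain ⟨k', w', e, hk⟩ := key (k :: w) (hs.trans (List.suffix_cons k w)) hr
  obtain ⟨rfl, rfl⟩ := List.cons.inj e
  exact (hk i hi).1

/-- This treats the moment a path leaves a {p, q}-geodesic. From coProd(p, i) x_i = coProd(p, q)
x_q, with |x_i| ≤ C and |x_q| ≥ R, the products with i have modulus at least εR/C ≥ K + 1. -/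
theorem Tame.dominant_branch {a : Fin n → ℂ} {ε K ρ : ℝ} (h : Tame a ε K) (hK : ρ ≤ K)
    {l : List (Fin n)} {p q i : Fin n} (hpq : p ≠ q) (hip : i ≠ p) (hiq : i ≠ q)
    {C R : ℝ} (hC : ∀ k, k ≠ p → k ≠ q → ‖pathVec a l k‖ ≤ C) (hCR : C ≤ R)
    (hR : (K + 1) * C ≤ ε * R) (hp : R ≤ ‖pathVec a l p‖)
    (hyz : ‖pathVec a l p‖ ≤ ‖pathVec a l q‖) :
    Dominant ρ K (pathVec a (i :: l)) i := by
  rw [pathVec_cons]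
  set x := pathVec a l with hx
  have hpos : ∀ k, 0 < ‖x k‖ := fun k => norm_pos_iff.mpr (h.ne_zero l k)
  have hK2 := h.two_lt
  have hCpos : 0 < C := (hpos i).trans_le (hC i hip hiq)
  have hRpos : 0 < R := hCpos.trans_le hCR
  have hφ := h.lower l p q hpq
  have big : ∀ r s, r ≠ s → i ≠ r → i ≠ s → R ≤ ‖x s‖ → ε ≤ ‖coProd x r s‖ →
      K + 1 ≤ ‖coProd x r i‖ := by
    intro r s hrs hir his hs hφ
    have e := coProd_mul_eq x hir.symm hrs
    have e2 : ‖coProd x r i‖ * ‖x i‖ = ‖coProd x r s‖ * ‖x s‖ := by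
      rw [← norm_mul, e, norm_mul]
    refine le_of_mul_le_mul_right ?_ (hpos i)
    rw [e2]
    calc (K + 1) * ‖x i‖ ≤ (K + 1) * C := by gcongr; exact hC i hip hiq
      _ ≤ ε * R := hR
      _ ≤ ‖coProd x r s‖ * ‖x s‖ := by gcongr
  have hq' : K + 1 ≤ ‖coProd x q i‖ :=
    big q p hpq.symm hiq hip hp (h.lower l q p hpq.symm)
  have hp' : K + 1 ≤ ‖coProd x p i‖ := big p q hpq hip hiq (hp.trans hyz) hφ
  have hle : ∀ k, ‖x k‖ ≤ ‖x q‖ := fun k => by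
    by_cases h1 : k = p
    · rw [h1]; exact hyz
    by_cases h2 : k = q
    · rw [h2]
    exact (hC k h1 h2).trans (hCR.trans (hp.trans hyz))
  have hbig : K * ‖x q‖ ≤ ‖flipAt i x i‖ := by
    rw [flipAt_self x hiq]
    have h1 := norm_sub_norm_le (coProd x i q * x q) (x i)
    rw [norm_mul, coProd_comm] at h1
    have h2 : (K + 1) * ‖x q‖ ≤ ‖coProd x q i‖ * ‖x q‖ := by gcongr
    have h3 := hle i
    rw [coProd_comm]
    linarith
  intro k hk
  refine ⟨?_, ?_⟩
  · rw [flipAt_ne x hk]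
    exact (mul_le_mul hK (hle k) (norm_nonneg _) (by linarith)).trans hbig
  · rw [coProd_flipAt]
    by_cases h1 : k = p
    · rw [h1, coProd_comm]; linarith
    by_cases h2 : k = q
    · rw [h2, coProd_comm]; linarith
    have e := coProd_mul_eq x hk.symm hiq
    have e2 : ‖coProd x i k‖ * ‖x k‖ = ‖coProd x q i‖ * ‖x q‖ := by
      rw [← norm_mul, ← norm_mul, e, coProd_comm x q]
    refine le_of_mul_le_mul_right ?_ (hpos k)
    rw [e2]
    exact mul_le_mul (by linarith) (hle k) (norm_nonneg _) (norm_nonneg _)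

theorem Tame.alternating_growth {a : Fin n → ℂ} {ε K : ℝ} (h : Tame a ε K) {c : ℕ → Fin n}
    (hc : ∀ k, c (k + 2) = c k) (hne : ∀ k, c k ≠ c (k + 1)) (l : List (Fin n)) :
    ∃ ρ : ℝ, 1 < ρ ∧ ∀ R : ℝ, ∀ᶠ k in atTop,
      R ≤ ‖pathVec a (extendBy c l k) (c k)‖ ∧
      ρ * ‖pathVec a (extendBy c l k) (c k)‖ ≤ ‖pathVec a (extendBy c l k) (c (k + 1))‖ := by
  set φ := coProd (pathVec a l) (c 0) (c 1) with hφ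
  have hseg : φ ∉ seg := h.notMem_seg l _ _ (hne 0)
  have hφ0 := ne_zero_of_notMem_seg hseg
  set b := bigRoot φ with hb
  have hb0 : b ≠ 0 := bigRoot_ne_zero hφ0
  have hb1 : 1 < ‖b‖ := one_lt_norm_bigRoot hseg
  set A := b * pathVec a l (c 1) - pathVec a l (c 0) with hA
  set B := pathVec a l (c 1) - b * pathVec a l (c 0) with hB
  have hA0 : A ≠ 0 := h.growing_ne_zero l (hne 0)
  have hB' : ∀ k : ℕ, ‖b⁻¹ ^ k * B‖ ≤ ‖B‖ := fun k => by
    rw [norm_mul, norm_pow, norm_inv]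
    exact mul_le_of_le_one_left (norm_nonneg _)
      (pow_le_one₀ (by positivity) (inv_le_one_of_one_le₀ hb1.le))
  have hs : b ^ 2 - 1 ≠ 0 := bigRoot_sq_ne_one hseg
  have hs' : 0 < ‖b ^ 2 - 1‖ := norm_pos_iff.mpr hs
  have hclosed := alternating_closed hc hne a l hb0 (bigRoot_add_inv hφ0)
  -- The true ratio tends to |b|; half of the excess |b| - 1 is given up to absorb the decaying
  -- component `B`, which is why `R'` below exceeds ‖B‖/((|b| - 1)/2).
  refine ⟨(1 + ‖b‖) / 2, by linarith, fun R => ?_⟩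
  have hlim : Tendsto (fun k : ℕ => ‖b‖ ^ k) atTop atTop := tendsto_pow_atTop_atTop_of_one_lt hb1
  set R' : ℝ := max R (‖B‖ / ((‖b‖ - 1) / 2)) with hR'
  filter_upwards [hlim.eventually_ge_atTop ((‖b ^ 2 - 1‖ * R' + ‖b‖ * ‖B‖) / ‖A‖)] with k hk
  obtain ⟨e1, e2⟩ := hclosed k
  set y := pathVec a (extendBy c l k) (c (k + 1))
  set z := pathVec a (extendBy c l k) (c k)
  have hz : R' ≤ ‖z‖ := by
    have e3 : (b ^ 2 - 1) * z = b ^ k * A - b * (b⁻¹ ^ k * B) := by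
      rw [← e1, ← e2]; ring
    have h1 := norm_sub_norm_le (b ^ k * A) (b * (b⁻¹ ^ k * B))
    rw [← e3, norm_mul (b ^ k), norm_mul b, norm_mul (b ^ 2 - 1), norm_pow b k] at h1
    have h2 : ‖b‖ * ‖b⁻¹ ^ k * B‖ ≤ ‖b‖ * ‖B‖ := by gcongr; exact hB' k
    rw [div_le_iff₀ (norm_pos_iff.mpr hA0)] at hk
    refine le_of_mul_le_mul_left ?_ hs'
    linarith
  refine ⟨(le_max_left _ _).trans hz, ?_⟩
  have h4 : y = b * z + b⁻¹ ^ k * B := by linear_combination e2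
  have h5 : ‖b‖ * ‖z‖ - ‖B‖ ≤ ‖y‖ := by
    have := norm_sub_norm_le (b * z) (-(b⁻¹ ^ k * B))
    rw [sub_neg_eq_add, ← h4, norm_neg, norm_mul] at this
    linarith [hB' k]
  have h6 : ‖B‖ / ((‖b‖ - 1) / 2) ≤ ‖z‖ := (le_max_right _ _).trans hz
  rw [div_le_iff₀ (by linarith)] at h6
  linarith

theorem Tame.eventuallyGrowing_of_alternating {a : Fin n → ℂ} {ε K : ℝ} (h : Tame a ε K)
    {c : ℕ → Fin n} (hc : ∀ k, c (k + 2) = c k) (hne : ∀ k, c k ≠ c (k + 1))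
    (l : List (Fin n)) : ∃ k, EventuallyGrowing a (extendBy c l k) := by
  obtain ⟨ρ, hρ, hev⟩ := h.alternating_growth hc hne l
  have hK := h.two_lt
  set C : ℝ := ∑ i, ‖pathVec a l i‖ with hC
  have hC0 : 0 ≤ C := Finset.sum_nonneg fun _ _ => norm_nonneg _
  have hCle : ∀ i, ‖pathVec a l i‖ ≤ C := fun i =>
    Finset.single_le_sum (f := fun i => ‖pathVec a l i‖) (fun _ _ => norm_nonneg _)
      (Finset.mem_univ i)
  set R : ℝ := (K + 1) * C / ε + C with hR
  have hCR : C ≤ R := by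
    have : 0 ≤ (K + 1) * C / ε := div_nonneg (by nlinarith) h.pos.le
    linarith
  have hRε : (K + 1) * C ≤ ε * R := by
    have h1 : ε * R = (K + 1) * C + ε * C := by
      rw [hR]; have := h.pos.ne'; field_simp
    have := mul_nonneg h.pos.le hC0
    linarith
  obtain ⟨k₀, hk₀⟩ := eventually_atTop.mp (hev R)
  have hconst : ∀ k m, m ≠ c k → m ≠ c (k + 1) → ‖pathVec a (extendBy c l k) m‖ ≤ C := by
    intro k m h0 h1
    rw [pathVec_extendBy_ne hc a l]
    · exact hCle m
    all_goals rcases eq_or_eq_of_periodic hc k with ⟨e, e'⟩ | ⟨e, e'⟩ <;> grind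
  refine ⟨k₀ + 1, min ρ (K / 2), lt_min hρ (by linarith), 0, ?_⟩
  -- An extension either still follows the alternating path, with ratio `ρ`, or has left it and is
  -- dominant with ratio K/2, which persists since K/2 ≤ K - 1.
  have key : ∀ w, extendBy c l (k₀ + 1) <:+ w → Reduced w →
      (∃ k ≥ k₀, w = extendBy c l (k + 1)) ∨
      ∃ i w', w = i :: w' ∧ Dominant (K / 2) K (pathVec a (i :: w')) i := by
    refine suffix_induction (fun _ => Or.inl ⟨k₀, le_rfl, rfl⟩) fun i w _ ih hr => ?_
    rcases ih hr.tail with ⟨k, hk, rfl⟩ | ⟨j, w', rfl, hd⟩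
    · by_cases hi : i = c (k + 1)
      · exact Or.inl ⟨k + 1, by omega, by rw [hi]; rfl⟩
      · right
        refine ⟨i, _, rfl, ?_⟩
        obtain ⟨h1, h2⟩ := hk₀ (k + 1) (by omega)
        have hik : i ≠ c k := by
          rw [Reduced, List.isChain_cons] at hr
          exact hr.1 (c k) rfl
        refine h.dominant_branch (by linarith) (hne (k + 1)) hi
          (by rw [hc]; exact hik) (fun m => hconst (k + 1) m) hCR hRε h1 ?_
        refine le_trans ?_ h2
        nlinarith [norm_nonneg (pathVec a (extendBy c l (k + 1)) (c (k + 1)))]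
    · right
      refine ⟨i, _, rfl, hd.flip (by linarith) (by linarith) (h.ne_zero _) ?_⟩
      rw [Reduced, List.isChain_cons] at hr
      exact hr.1 j rfl
  intro w j hr hs _ i hi
  rcases key (j :: w) (hs.trans (List.suffix_cons j w)) hr with ⟨k, hk, e⟩ | ⟨j', w', e, hd⟩
  · have hj : j = c k := (List.cons.inj e).1
    rw [e]
    obtain ⟨h1, h2⟩ := hk₀ (k + 1) (by omega)
    rw [hc, ← hj] at h2
    refine le_trans ?_ h2
    have : ‖pathVec a (extendBy c l (k + 1)) i‖ ≤ ‖pathVec a (extendBy c l (k + 1)) (c (k + 1))‖ := by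
      by_cases hi' : i = c (k + 1)
      · rw [hi']
      · exact (hconst (k + 1) i hi' (by rw [hc, ← hj]; exact hi)).trans (hCR.trans h1)
    exact mul_le_mul (min_le_left _ _) this (norm_nonneg _) (by linarith)
  · obtain ⟨rfl, rfl⟩ := List.cons.inj e
    refine le_trans ?_ (hd i hi).1
    gcongr
    exact min_le_right _ _

theorem Tame.eventuallyGrowing_of_large {a : Fin n → ℂ} {ε K : ℝ} (h : Tame a ε K)
    {f : ℕ → Fin n} (hne : ∀ k, f k ≠ f (k + 1)) {M : ℕ}
    (hM : ∀ m ≥ M, ∀ i, i ≠ f m → K < ‖coProd (pathVec a (extendBy f [] (m + 1))) (f m) i‖) :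
    ∃ k, EventuallyGrowing a (extendBy f [] k) := by
  by_contra hcon
  push Not at hcon
  have hK := h.two_lt
  set X : ℕ → Fin n → ℂ := fun m => pathVec a (extendBy f [] m) with hX
  have hstep : ∀ m, X (m + 1) = flipAt (f m) (X m) := fun m => rfl
  -- If the coordinate about to be flipped did not dominate, the flip would increase it, the new
  -- vector would be dominant, and growth would follow. So every flip acts on the dominant
  -- coordinate.
  have hdom : ∀ m ≥ M, ∀ i, K / 2 * ‖X m i‖ ≤ ‖X m (f m)‖ ∨ i = f m := by
    intro m hm i
    by_cases hi : i = f m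
    · exact Or.inr hi
    left
    have hsum : ∀ k, k ≠ f m → K * ‖X m k‖ ≤ ‖X (m + 1) (f m)‖ + ‖X m (f m)‖ := by
      intro k hk
      have e : coProd (X (m + 1)) (f m) k * X m k = X (m + 1) (f m) + X m (f m) := by
        rw [hstep, coProd_flipAt, flipAt_self _ hk.symm]; ring
      calc K * ‖X m k‖ ≤ ‖coProd (X (m + 1)) (f m) k‖ * ‖X m k‖ := by
            gcongr; exact (hM m hm k hk).le
        _ = ‖X (m + 1) (f m) + X m (f m)‖ := by rw [← norm_mul, e]
        _ ≤ _ := norm_add_le _ _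
    by_contra hlt
    push Not at hlt
    have hasc : ‖X m (f m)‖ ≤ ‖X (m + 1) (f m)‖ := by
      have := hsum i hi; linarith
    refine hcon (m + 1) (h.eventuallyGrowing_of_dominant (ρ := K / 2) (by linarith) (by linarith) ?_)
    intro k hk
    refine ⟨?_, (hM m hm k hk).le⟩
    have := hsum k hk
    change K / 2 * ‖X (m + 1) k‖ ≤ ‖X (m + 1) (f m)‖
    rw [show X (m + 1) k = X m k from flipAt_ne _ hk]
    linarith
  -- Perpetual descent shrinks the largest coordinate geometrically; eventually all moduli are at
  -- most 1, and no product can exceed K.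
  have hdecr : ∀ k, ‖X (M + k) (f (M + k))‖ ≤ (2 / K) ^ k * ‖X M (f M)‖ := by
    intro k
    induction k with
    | zero => simp
    | succ k ih =>
      have hk := hne (M + k)
      rw [← add_assoc, hstep, flipAt_ne _ hk.symm]
      have h1 := (hdom (M + k) (by omega) (f (M + k + 1))).resolve_right hk.symm
      have h2 : ‖X (M + k) (f (M + k + 1))‖ ≤ 2 / K * ‖X (M + k) (f (M + k))‖ := by
        rw [div_mul_eq_mul_div, le_div_iff₀ (by linarith)]; linarith
      calc _ ≤ 2 / K * ‖X (M + k) (f (M + k))‖ := h2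
        _ ≤ 2 / K * ((2 / K) ^ k * ‖X M (f M)‖) := by gcongr
        _ = _ := by rw [pow_succ]; ring
  have hlim : Tendsto (fun k : ℕ => (2 / K) ^ k * ‖X M (f M)‖) atTop (𝓝 (0 * _)) :=
    (tendsto_pow_atTop_nhds_zero_of_lt_one (by positivity)
      (by rw [div_lt_one (by linarith)]; exact hK)).mul_const _
  rw [zero_mul] at hlim
  obtain ⟨k, hk⟩ := (hlim.eventually_le_const one_pos).exists
  have hle : ∀ i, ‖X (M + k) i‖ ≤ 1 := by
    intro i
    have h1 := (hdecr k).trans hk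
    rcases hdom (M + k) (by omega) i with h2 | rfl
    · nlinarith [norm_nonneg (X (M + k) i)]
    · exact h1
  obtain ⟨i, hi, -⟩ := exists_third h.three_le (f (M + k)) (f (M + k))
  have h3 := hM (M + k) (by omega) i hi
  rw [extendBy, pathVec_cons, coProd_flipAt, coProd, norm_prod] at h3
  have h4 : ∏ r ∈ ({f (M + k), i} : Finset (Fin n))ᶜ, ‖pathVec a (extendBy f [] (M + k)) r‖ ≤ 1 :=
    Finset.prod_le_one (fun _ _ => norm_nonneg _) fun r _ => hle r
  linarith

/-- König's lemma: failure passes from a word to one of its finitely many extensions, and the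
resulting ray contradicts one of the two preceding results. -/
theorem Tame.eventuallyGrowing {a : Fin n → ℂ} {ε K : ℝ} (h : Tame a ε K) :
    EventuallyGrowing a [] := by
  by_contra hcon
  have hstep : ∀ l : {l : List (Fin n) // ¬ EventuallyGrowing a l},
      ∃ i, ¬ EventuallyGrowing a (i :: l.1) := by
    intro l
    by_contra hall
    push Not at hall
    exact l.2 (EventuallyGrowing.of_cons (by have := h.three_le; omega) hall)
  choose g hg using hstep
  let s : ℕ → {l : List (Fin n) // ¬ EventuallyGrowing a l} :=
    fun m => Nat.rec ⟨[], hcon⟩ (fun _ l => ⟨g l :: l.1, hg l⟩) m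
  set f : ℕ → Fin n := fun m => g (s m) with hf
  have hs : ∀ m, extendBy f [] m = (s m).1 := by
    intro m
    induction m with
    | zero => rfl
    | succ m ih => rw [extendBy, ih]
  have hnot : ∀ m, ¬ EventuallyGrowing a (extendBy f [] m) := fun m => by
    rw [hs]; exact (s m).2
  have hne : ∀ k, f k ≠ f (k + 1) := by
    intro k e
    -- A repeated letter leaves no reduced extension, so growth would hold vacuously.
    refine hnot (k + 2) ⟨2, by norm_num, 0, fun w j hr hw _ => ?_⟩
    exfalso
    have h1 : Reduced (extendBy f [] (k + 2)) := hr.tail.suffix hw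
    rw [extendBy, extendBy, Reduced, List.isChain_cons] at h1
    exact h1.1 (f k) rfl e.symm
  rcases h.ray f hne with ⟨M, hM⟩ | ⟨M, hM⟩
  · obtain ⟨k, hk⟩ := h.eventuallyGrowing_of_alternating (c := fun r => f (M + r))
      (fun k => hM k) (fun k => hne (M + k)) (extendBy f [] M)
    rw [← extendBy_add] at hk
    exact hnot _ hk
  · obtain ⟨k, hk⟩ := h.eventuallyGrowing_of_large hne hM
    exact hnot k hk

end Growth

/-! ### Sums over the reduced words of given length -/

section Levels

variable {n : ℕ}

/-- The labels by which a reduced word can be extended. -/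
def nextLabels (l : List (Fin n)) : Finset (Fin n) := {i | i ∉ l.head?}

theorem mem_nextLabels {l : List (Fin n)} {i : Fin n} : i ∈ nextLabels l ↔ i ∉ l.head? := by
  simp [nextLabels]

theorem nextLabels_nil : nextLabels ([] : List (Fin n)) = Finset.univ := by
  ext; simp [mem_nextLabels]

theorem nextLabels_cons (j : Fin n) (l : List (Fin n)) :
    nextLabels (j :: l) = Finset.univ.erase j := by
  ext i; simp [mem_nextLabels, eq_comm]

theorem reduced_cons {l : List (Fin n)} {i : Fin n} :
    Reduced (i :: l) ↔ i ∈ nextLabels l ∧ Reduced l := by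
  rw [Reduced, List.isChain_cons, mem_nextLabels]
  exact and_congr_left fun _ => ⟨fun h e => h i e rfl, fun h y hy e => h (e ▸ hy)⟩

/-- The reduced words of length `N`. -/
def wordsOf (n : ℕ) : ℕ → Finset (List (Fin n))
  | 0 => {[]}
  | N + 1 => (wordsOf n N).biUnion fun l => (nextLabels l).image (· :: l)

theorem mem_wordsOf {N : ℕ} {l : List (Fin n)} :
    l ∈ wordsOf n N ↔ Reduced l ∧ l.length = N := by
  induction N generalizing l with
  | zero =>
    rw [wordsOf, Finset.mem_singleton, List.length_eq_zero_iff]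
    exact ⟨fun h => ⟨h ▸ List.IsChain.nil, h⟩, fun h => h.2⟩
  | succ N ih =>
    simp only [wordsOf, Finset.mem_biUnion, Finset.mem_image, ih]
    constructor
    · rintro ⟨l', ⟨hr, rfl⟩, i, hi, rfl⟩
      exact ⟨reduced_cons.mpr ⟨hi, hr⟩, rfl⟩
    · rintro ⟨hr, hl⟩
      cases l with
      | nil => simp at hl
      | cons i l =>
        obtain ⟨hi, hr⟩ := reduced_cons.mp hr
        exact ⟨l, ⟨hr, by simpa using hl⟩, i, hi, rfl⟩

theorem sum_wordsOf_succ {M : Type*} [AddCommMonoid M] (f : List (Fin n) → M) (N : ℕ) :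
    ∑ l ∈ wordsOf n (N + 1), f l = ∑ l ∈ wordsOf n N, ∑ i ∈ nextLabels l, f (i :: l) := by
  rw [wordsOf, Finset.sum_biUnion]
  · refine Finset.sum_congr rfl fun l _ => ?_
    rw [Finset.sum_image]
    intro i _ j _ h
    exact (List.cons.inj h).1
  · intro l _ l' _ hne
    rw [Function.onFun, Finset.disjoint_left]
    rintro _ h h'
    obtain ⟨i, -, rfl⟩ := Finset.mem_image.mp h
    obtain ⟨j, -, e⟩ := Finset.mem_image.mp h'
    exact hne (List.cons.inj e).2.symm

theorem sum_wordsOf_zero {M : Type*} [AddCommMonoid M] (f : List (Fin n) → M) :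
    ∑ l ∈ wordsOf n 0, f l = f [] := by simp [wordsOf]

/-- The reduced words of length less than `M`. -/
def ballWords (n M : ℕ) : Finset {l : List (Fin n) // Reduced l} :=
  ((Finset.range M).biUnion (wordsOf n)).subtype _

theorem mem_ballWords {M : ℕ} {l : {l : List (Fin n) // Reduced l}} :
    l ∈ ballWords n M ↔ l.1.length < M := by
  simp [ballWords, mem_wordsOf, l.2]

theorem sum_ballWords {A : Type*} [AddCommMonoid A] (f : List (Fin n) → A) (M : ℕ) :
    ∑ l ∈ ballWords n M, f l.1 = ∑ N ∈ Finset.range M, ∑ l ∈ wordsOf n N, f l := by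
  rw [ballWords, Finset.sum_subtype_of_mem f, Finset.sum_biUnion]
  · intro N _ N' _ hne
    rw [Function.onFun, Finset.disjoint_left]
    intro l h h'
    exact hne ((mem_wordsOf.mp h).2.symm.trans (mem_wordsOf.mp h').2)
  · intro l hl
    obtain ⟨N, -, h⟩ := Finset.mem_biUnion.mp hl
    exact (mem_wordsOf.mp h).1

theorem tendsto_ballWords : Tendsto (ballWords n) atTop atTop := by
  refine tendsto_atTop_finset_of_monotone ?_ fun l => ⟨l.1.length + 1, ?_⟩
  · intro M M' h l hl
    rw [mem_ballWords] at hl ⊢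
    omega
  · rw [mem_ballWords]; omega

theorem HasSum.tendsto_levels {f : List (Fin n) → ℂ} {S : ℂ}
    (h : HasSum (fun l : {l : List (Fin n) // Reduced l} => f l.1) S) :
    Tendsto (fun M => ∑ N ∈ Finset.range M, ∑ l ∈ wordsOf n N, f l) atTop (𝓝 S) := by
  simp only [← sum_ballWords]
  have h' : Tendsto (fun s : Finset {l : List (Fin n) // Reduced l} => ∑ l ∈ s, f l.1)
      atTop (𝓝 S) := by simpa [HasSum] using h
  exact h'.comp tendsto_ballWords

theorem tendsto_level_zero {f : List (Fin n) → ℂ}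
    (h : Summable fun l : {l : List (Fin n) // Reduced l} => f l.1) :
    Tendsto (fun N => ∑ l ∈ wordsOf n N, f l) atTop (𝓝 0) := by
  have h1 := HasSum.tendsto_levels h.hasSum
  have h2 := (h1.comp (tendsto_add_atTop_nat 1)).sub h1
  rw [sub_self] at h2
  refine h2.congr fun N => ?_
  simp [Finset.sum_range_succ]

theorem summable_of_level_contraction {f : List (Fin n) → ℝ} (hf : ∀ l, 0 ≤ f l) {q : ℝ}
    (hq : q < 1) {N₀ : ℕ}
    (h : ∀ l, Reduced l → N₀ ≤ l.length → ∑ i ∈ nextLabels l, f (i :: l) ≤ q * f l) :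
    Summable fun l : {l : List (Fin n) // Reduced l} => f l.1 := by
  have hlev : Summable fun N => ∑ l ∈ wordsOf n N, f l := by
    refine summable_of_ratio_norm_eventually_le hq ?_
    filter_upwards [eventually_ge_atTop N₀] with N hN
    rw [Real.norm_of_nonneg (Finset.sum_nonneg fun l _ => hf l),
      Real.norm_of_nonneg (Finset.sum_nonneg fun l _ => hf l), sum_wordsOf_succ, Finset.mul_sum]
    refine Finset.sum_le_sum fun l hl => ?_
    obtain ⟨hr, rfl⟩ := mem_wordsOf.mp hl
    exact h l hr hN
  refine summable_of_sum_le (fun l => hf l.1) (c := ∑' N, ∑ l ∈ wordsOf n N, f l) fun u => ?_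
  obtain ⟨M, hM⟩ := (tendsto_ballWords (n := n)).eventually_ge_atTop u |>.exists
  calc ∑ l ∈ u, f l.1 ≤ ∑ l ∈ ballWords n M, f l.1 :=
        Finset.sum_le_sum_of_subset_of_nonneg hM fun l _ _ => hf l.1
    _ = ∑ N ∈ Finset.range M, ∑ l ∈ wordsOf n N, f l := sum_ballWords f M
    _ ≤ _ := hlev.sum_le_tsum _ fun N _ => Finset.sum_nonneg fun l _ => hf l

theorem finite_short_words (N : ℕ) :
    {l : {l : List (Fin n) // Reduced l} | l.1.length < N}.Finite := by
  refine (ballWords n N).finite_toSet.subset fun l hl => ?_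
  exact mem_ballWords.mpr hl

/-- A criterion for the sum of a family over the alternating geodesics. -/
theorem hasSum_root {F : Finset (Fin n) → List (Fin n) → ℂ} {g : List (Fin n) → ℝ}
    (hg : Summable fun l : {l : List (Fin n) // Reduced l} => g l.1) {N₀ : ℕ}
    (hb : ∀ I l, I.card = 2 → Reduced l → N₀ ≤ l.length → I ⊆ nextLabels l → ‖F I l‖ ≤ g l) {S : ℂ}
    (hS : Tendsto (fun M => ∑ N ∈ Finset.range M, ∑ l ∈ wordsOf n N,
      ∑ I ∈ (nextLabels l).powersetCard 2, F I l) atTop (𝓝 S)) :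
    HasSum (fun r : Root n => F r.1.1.1 r.1.2.1) S := by
  classical
  set G : {I : Finset (Fin n) // I.card = 2} × {l : List (Fin n) // Reduced l} → ℂ :=
    Set.indicator {p | ∀ k ∈ p.2.1.head?, k ∉ p.1.1} (fun p => F p.1.1 p.2.1) with hG
  have hmem : ∀ p : {I : Finset (Fin n) // I.card = 2} × {l : List (Fin n) // Reduced l},
      (∀ k ∈ p.2.1.head?, k ∉ p.1.1) ↔ p.1.1 ⊆ nextLabels p.2.1 := by
    intro p
    constructor
    · exact fun h i hi => mem_nextLabels.mpr fun hk => h i hk hi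
    · exact fun h k hk hi => mem_nextLabels.mp (h hi) hk
  have hGval : ∀ p, G p = if p.1.1 ⊆ nextLabels p.2.1 then F p.1.1 p.2.1 else 0 := by
    intro p
    rw [hG, Set.indicator_apply]
    simp only [Set.mem_ofPred_eq, hmem]
  suffices h : HasSum G S by
    exact (hasSum_subtype_iff_indicator (f := fun p : {I : Finset (Fin n) // I.card = 2} ×
      {l : List (Fin n) // Reduced l} => F p.1.1 p.2.1)
      (s := {p | ∀ k ∈ p.2.1.head?, k ∉ p.1.1})).mpr h
  have hsum : Summable G := by
    have h1 : Summable fun p : {I : Finset (Fin n) // I.card = 2} ×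
        {l : List (Fin n) // Reduced l} => (1 : ℝ) * |g p.2.1| :=
      Summable.mul_of_nonneg (f := fun _ : {I : Finset (Fin n) // I.card = 2} => (1 : ℝ))
        (Summable.of_finite) hg.abs (fun _ => zero_le_one) (fun _ => abs_nonneg _)
    -- The bound ignores `I`, which ranges over a finite set, and is needed only off finitely many
    -- short words.
    refine Summable.of_norm_bounded_eventually h1 ?_
    have hfin : {p : {I : Finset (Fin n) // I.card = 2} × {l : List (Fin n) // Reduced l} |
        p.2.1.length < N₀}.Finite := by
      refine (Set.Finite.prod (Set.finite_univ (α := {I : Finset (Fin n) // I.card = 2}))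
        (finite_short_words N₀)).subset ?_
      intro p hp
      exact ⟨trivial, hp⟩
    filter_upwards [hfin.compl_mem_cofinite] with p hp
    rw [hGval, one_mul]
    split_ifs with hI
    · exact (hb _ _ p.1.2 p.2.2 (not_lt.mp hp) hI).trans (le_abs_self _)
    · simp
  -- With summability known, the value is found by summing over `I` first and comparing with the
  -- limit over balls.
  have h2 := ((Equiv.prodComm _ _).hasSum_iff.mpr hsum.hasSum).prod_fiberwise
    (fun l => hasSum_fintype _)
  have h3 : HasSum (fun l : {l : List (Fin n) // Reduced l} =>
      (fun l => ∑ I ∈ (nextLabels l).powersetCard 2, F I l) l.1) (∑' p, G p) := by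
    refine Eq.mp (congrArg (fun f => HasSum f _) (funext fun l => ?_)) h2
    simp only [Function.comp, Equiv.prodComm_apply, Prod.swap_prod_mk, hGval]
    rw [← Finset.sum_filter]
    refine Finset.sum_bij (fun I _ => I.1) ?_ ?_ ?_ ?_
    · intro I hI
      exact Finset.mem_powersetCard.mpr ⟨(Finset.mem_filter.mp hI).2, I.2⟩
    · intro I _ J _ h
      exact Subtype.ext h
    · intro I hI
      obtain ⟨h1, h2⟩ := Finset.mem_powersetCard.mp hI
      exact ⟨⟨I, h2⟩, Finset.mem_filter.mpr ⟨Finset.mem_univ _, h1⟩, rfl⟩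
    · intro I _
      rfl
  rw [tendsto_nhds_unique hS (HasSum.tendsto_levels h3)]
  exact hsum.hasSum

end Levels

/-! ### Summability estimates -/

section Estimates

variable {n : ℕ}

theorem exists_pos_le_of_finset {α : Type*} (s : Finset α) (f : α → ℝ) (h : ∀ p, 0 < f p) :
    ∃ m : ℝ, 0 < m ∧ m ≤ 1 ∧ ∀ p ∈ s, m ≤ f p := by
  classical
  induction s using Finset.induction_on with
  | empty => exact ⟨1, one_pos, le_rfl, by simp⟩
  | insert a s _ ih =>
    obtain ⟨m, h0, h1, hm⟩ := ih
    refine ⟨min m (f a), lt_min h0 (h a), (min_le_left _ _).trans h1, fun p hp => ?_⟩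
    rcases Finset.mem_insert.mp hp with rfl | hp
    · exact min_le_right _ _
    · exact (min_le_left _ _).trans (hm p hp)

theorem pow_le_prod_norm {x : Fin n → ℂ} {m : ℝ} (h0 : 0 < m) (h1 : m ≤ 1)
    (h : ∀ k, m ≤ ‖x k‖) (s : Finset (Fin n)) : m ^ n ≤ ∏ k ∈ s, ‖x k‖ := by
  calc m ^ n ≤ m ^ s.card :=
        pow_le_pow_of_le_one h0.le h1 (by simpa using s.card_le_univ)
    _ = ∏ k ∈ s, m := by simp
    _ ≤ _ := Finset.prod_le_prod (fun _ _ => h0.le) fun k _ => h k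

theorem mul_prod_le_prod_norm {x : Fin n → ℂ} {m : ℝ} (h0 : 0 < m) (h1 : m ≤ 1)
    (h : ∀ k, m ≤ ‖x k‖) {s u : Finset (Fin n)} (hs : s ⊆ u) :
    m ^ n * ∏ k ∈ s, ‖x k‖ ≤ ∏ k ∈ u, ‖x k‖ := by
  rw [← Finset.prod_sdiff hs]
  exact mul_le_mul_of_nonneg_right (pow_le_prod_norm h0 h1 h _)
    (Finset.prod_nonneg fun _ _ => norm_nonneg _)

theorem norm_prod_flipAt (x : Fin n → ℂ) (i : Fin n) :
    ‖∏ k, flipAt i x k‖ = ‖flipAt i x i‖ * ‖∏ k ∈ Finset.univ.erase i, x k‖ := by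
  rw [← Finset.mul_prod_erase _ _ (Finset.mem_univ i), norm_mul]
  congr 2
  exact Finset.prod_congr rfl fun k hk => flipAt_ne x (Finset.ne_of_mem_erase hk)

theorem mul_norm_prod_le_flipAt {x : Fin n → ℂ} {i : Fin n} {κ : ℝ}
    (h : κ * ‖x i‖ ≤ ‖flipAt i x i‖) : κ * ‖∏ k, x k‖ ≤ ‖∏ k, flipAt i x k‖ := by
  rw [norm_prod_flipAt, ← Finset.mul_prod_erase _ _ (Finset.mem_univ i), norm_mul, ← mul_assoc]
  gcongr

/-- The cube root. -/
noncomputable def cbrt (r : ℝ) : ℝ := r ^ ((3 : ℕ) : ℝ)⁻¹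

theorem cbrt_nonneg {r : ℝ} (h : 0 ≤ r) : 0 ≤ cbrt r := Real.rpow_nonneg h _

theorem cbrt_pow {r : ℝ} (h : 0 ≤ r) : cbrt r ^ 3 = r :=
  Real.rpow_inv_natCast_pow h three_ne_zero

theorem cbrt_cube {r : ℝ} (h : 0 ≤ r) : cbrt (r ^ 3) = r :=
  Real.pow_rpow_inv_natCast h three_ne_zero

theorem cbrt_le {r s : ℝ} (h : 0 ≤ r) (hs : r ≤ s) : cbrt r ≤ cbrt s :=
  Real.rpow_le_rpow h hs (by positivity)

theorem cbrt_mul {r s : ℝ} (h : 0 ≤ r) (hs : 0 ≤ s) : cbrt (r * s) = cbrt r * cbrt s :=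
  Real.mul_rpow h hs

theorem cbrt_lt_one {r : ℝ} (h : 0 ≤ r) (h1 : r < 1) : cbrt r < 1 :=
  Real.rpow_lt_one h h1 (by positivity)

/-- The cube root of the inverse of the modulus of the product of the coordinates. -/
noncomputable def weight (a : Fin n → ℂ) (l : List (Fin n)) : ℝ :=
  cbrt ‖∏ k, pathVec a l k‖⁻¹

theorem weight_nonneg (a : Fin n → ℂ) (l : List (Fin n)) : 0 ≤ weight a l :=
  cbrt_nonneg (by positivity)

theorem weight_cons_le {a : Fin n → ℂ} {l : List (Fin n)} {i : Fin n} {κ : ℝ} (hκ : 0 < κ)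
    (h0 : ∀ k, pathVec a l k ≠ 0)
    (h : κ * ‖pathVec a l i‖ ≤ ‖pathVec a (i :: l) i‖) :
    weight a (i :: l) ≤ cbrt κ⁻¹ * weight a l := by
  have hpos : 0 < ‖∏ k, pathVec a l k‖ :=
    norm_pos_iff.mpr (Finset.prod_ne_zero_iff.mpr fun k _ => h0 k)
  rw [weight, weight, ← cbrt_mul (by positivity) (by positivity), ← mul_inv]
  refine cbrt_le (by positivity) (inv_anti₀ (by positivity) ?_)
  exact mul_norm_prod_le_flipAt h

/-- The growth of the coordinates along long reduced words. -/
structure Grows (a : Fin n → ℂ) (ρ m : ℝ) (N : ℕ) : Prop where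
  one_lt : 1 < ρ
  pos : 0 < m
  le_one : m ≤ 1
  ne_zero : ∀ l k, pathVec a l k ≠ 0
  dom : ∀ w j, Reduced (j :: w) → N ≤ w.length → ∀ i, i ≠ j →
    ρ * ‖pathVec a (j :: w) i‖ ≤ ‖pathVec a (j :: w) j‖
  lower : ∀ l, Reduced l → N + 1 ≤ l.length → ∀ k, m ≤ ‖pathVec a l k‖

/-- One factor ρ comes from x_j dominating the old x_i, the other from the new x_i dominating x_j.
-/
theorem sq_mul_le_of_dom {a : Fin n → ℂ} {ρ : ℝ} {N : ℕ} (h1 : 1 < ρ)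
    (hdom : ∀ w j, Reduced (j :: w) → N ≤ w.length → ∀ i, i ≠ j →
      ρ * ‖pathVec a (j :: w) i‖ ≤ ‖pathVec a (j :: w) j‖) {w : List (Fin n)} {i j : Fin n}
    (hr : Reduced (i :: j :: w)) (hw : N ≤ w.length) :
    ρ ^ 2 * ‖pathVec a (j :: w) i‖ ≤ ‖pathVec a (i :: j :: w) i‖ := by
  have hij : i ≠ j := by
    obtain ⟨h, -⟩ := reduced_cons.mp hr
    rw [nextLabels_cons] at h
    exact Finset.ne_of_mem_erase h
  have h2 := hdom w j hr.tail hw i hij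
  have h3 := hdom (j :: w) i hr (by simp; omega) j hij.symm
  rw [pathVec_cons a i, flipAt_ne _ hij.symm] at h3
  rw [pathVec_cons a i]
  nlinarith

theorem Tame.exists_grows {a : Fin n → ℂ} {ε K : ℝ} (h : Tame a ε K) :
    ∃ ρ m N, Grows a ρ m N := by
  obtain ⟨ρ, hρ, N, hN⟩ := h.eventuallyGrowing
  have hdom : ∀ w j, Reduced (j :: w) → N ≤ w.length → ∀ i, i ≠ j →
      ρ * ‖pathVec a (j :: w) i‖ ≤ ‖pathVec a (j :: w) j‖ :=
    fun w j hr hw => hN w j hr (List.nil_suffix) hw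
  -- The minimum over words of length N + 1 bounds all longer words too, since there each flip only
  -- enlarges the flipped coordinate.
  obtain ⟨m, h0, h1, hm⟩ := exists_pos_le_of_finset (wordsOf n (N + 1) ×ˢ Finset.univ)
    (fun p : List (Fin n) × Fin n => ‖pathVec a p.1 p.2‖)
    (fun p => norm_pos_iff.mpr (h.ne_zero _ _))
  refine ⟨ρ, m, N, hρ, h0, h1, h.ne_zero, hdom, fun l => ?_⟩
  induction l with
  | nil => intro _ h; simp at h
  | cons i l ih =>
    intro hr hl k
    by_cases hlen : l.length = N
    · exact hm (i :: l, k)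
        (Finset.mem_product.mpr ⟨mem_wordsOf.mpr ⟨hr, by simp [hlen]⟩, Finset.mem_univ _⟩)
    have hl' : N + 1 ≤ l.length := by simp at hl; omega
    have hk := ih hr.tail hl' k
    by_cases hki : k = i
    · subst hki
      cases l with
      | nil => simp at hl'
      | cons j w =>
        refine hk.trans (le_trans ?_ (sq_mul_le_of_dom hρ hdom hr (by simpa using hl')))
        exact le_mul_of_one_le_left (norm_nonneg _) (one_le_pow₀ hρ.le)
    · rwa [pathVec_cons, flipAt_ne _ hki]

theorem Grows.sq_mul_le {a : Fin n → ℂ} {ρ m : ℝ} {N : ℕ} (h : Grows a ρ m N)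
    {w : List (Fin n)} {i j : Fin n} (hr : Reduced (i :: j :: w)) (hw : N ≤ w.length) :
    ρ ^ 2 * ‖pathVec a (j :: w) i‖ ≤ ‖pathVec a (i :: j :: w) i‖ :=
  sq_mul_le_of_dom h.one_lt h.dom hr hw

theorem Grows.norm_prod_le {a : Fin n → ℂ} {ρ m : ℝ} {N : ℕ} (h : Grows a ρ m N)
    {w : List (Fin n)} {i j : Fin n} (hr : Reduced (i :: j :: w)) (hw : N ≤ w.length) :
    ‖∏ k, pathVec a (j :: w) k‖ ≤ ‖∏ k, pathVec a (i :: j :: w) k‖ := by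
  have := mul_norm_prod_le_flipAt (x := pathVec a (j :: w)) (i := i) (κ := 1)
    (le_trans (mul_le_mul_of_nonneg_right (one_le_pow₀ h.one_lt.le) (norm_nonneg _))
      (h.sq_mul_le hr hw))
  rwa [one_mul] at this

theorem Grows.mul_pow_le {a : Fin n → ℂ} {ρ m : ℝ} {N : ℕ} (h : Grows a ρ m N) (r : ℕ) :
    ∀ j w, Reduced (j :: w) → N + r ≤ w.length → m * ρ ^ r ≤ ‖pathVec a (j :: w) j‖ := by
  induction r with
  | zero =>
    intro j w hr hw
    simpa using h.lower _ hr (by simpa using hw) j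
  | succ r ih =>
    intro j w hr hw
    cases w with
    | nil => simp at hw
    | cons k w =>
      have hjk : k ≠ j := by
        obtain ⟨h, -⟩ := reduced_cons.mp hr
        rw [nextLabels_cons] at h
        exact (Finset.ne_of_mem_erase h).symm
      have h1 := ih k w hr.tail (by simp at hw; omega)
      have h2 := h.dom (k :: w) j hr (by omega) k hjk
      rw [pathVec_cons, flipAt_ne _ hjk] at h2
      have := h.one_lt
      rw [pow_succ, pathVec_cons]
      nlinarith

/-- After `j :: k :: w`, flipping k again gains only the factor ρ² in the product. Any other flip
multiplies x_i by at least about δ|x_j|, which is huge far out. Thus one child keeps a fraction q₀ <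
1 of the weight, and the others keep at most η each. -/
theorem Grows.summable_weight {a : Fin n → ℂ} {ρ m : ℝ} {N : ℕ} (h : Grows a ρ m N) :
    Summable fun l : {l : List (Fin n) // Reduced l} => weight a l.1 := by
  have hρ := h.one_lt
  have hm := h.pos
  set q₀ := cbrt (ρ ^ 2)⁻¹ with hq₀
  have hq0 : 0 ≤ q₀ := cbrt_nonneg (by positivity)
  have hq1 : q₀ < 1 := cbrt_lt_one (by positivity) (inv_lt_one_of_one_lt₀ (by nlinarith))
  set η : ℝ := (1 - q₀) / (2 * (n + 1)) with hη
  have hη0 : 0 < η := div_pos (by linarith) (by positivity)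
  set δ := m ^ n with hδ
  have hδ0 : 0 < δ := by positivity
  have hlim : Tendsto (fun r : ℕ => ρ ^ r) atTop atTop := tendsto_pow_atTop_atTop_of_one_lt hρ
  -- This `r` gives δ|x_j| ≥ η⁻³ + 1; the extra 1 absorbs the term -x_i of the flip, and the cube is
  -- undone by the cube root in the weight.
  obtain ⟨r, hr⟩ := (hlim.eventually_ge_atTop (((η ^ 3)⁻¹ + 1) / (δ * m))).exists
  have hnη : q₀ + n * η < 1 := by
    have : (n : ℝ) * η ≤ (1 - q₀) / 2 := by
      rw [hη, mul_div_assoc', div_le_div_iff₀ (by positivity) (by norm_num)]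
      nlinarith
    linarith
  refine summable_of_level_contraction (weight_nonneg a) hnη (N₀ := N + r + 2) fun l hl hlen => ?_
  rcases l with _ | ⟨j, _ | ⟨k, w⟩⟩
  · simp at hlen
  · simp at hlen
  simp only [List.length_cons] at hlen
  have hjk : k ≠ j := by
    obtain ⟨h, -⟩ := reduced_cons.mp hl
    rw [nextLabels_cons] at h
    exact (Finset.ne_of_mem_erase h).symm
  have ht := weight_nonneg a (j :: k :: w)
  have key : ∀ i ∈ nextLabels (j :: k :: w), weight a (i :: j :: k :: w) ≤
      (if i = k then q₀ * weight a (j :: k :: w) else 0) + η * weight a (j :: k :: w) := by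
    intro i hi
    have hred : Reduced (i :: j :: k :: w) := reduced_cons.mpr ⟨hi, hl⟩
    have hij : i ≠ j := by
      rw [nextLabels_cons] at hi; exact Finset.ne_of_mem_erase hi
    by_cases hik : i = k
    · rw [if_pos hik]
      have h1 := weight_cons_le (by positivity) (h.ne_zero _)
        (h.sq_mul_le hred (by simp; omega))
      nlinarith
    · rw [if_neg hik, zero_add]
      have hx := h.lower (j :: k :: w) hl (by simp; omega)
      have hbig := h.mul_pow_le r j (k :: w) hl (by simp; omega)
      have hik' : ‖pathVec a (j :: k :: w) i‖ ≤ ‖pathVec a (j :: k :: w) k‖ := by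
        have h1 := h.dom w k hl.tail (by omega) i hik
        rw [pathVec_cons a j, flipAt_ne _ hij, flipAt_ne _ hjk]
        nlinarith [norm_nonneg (pathVec a (k :: w) i)]
      have h3 : (η ^ 3)⁻¹ * ‖pathVec a (j :: k :: w) i‖ ≤ ‖pathVec a (i :: j :: k :: w) i‖ := by
        rw [pathVec_cons a i]
        set x := pathVec a (j :: k :: w)
        have h4 : δ * (‖x j‖ * ‖x k‖) ≤ ‖∏ s ∈ Finset.univ.erase i, x s‖ := by
          rw [norm_prod, ← Finset.prod_pair (f := fun s => ‖x s‖) hjk.symm]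
          refine mul_prod_le_prod_norm hm h.le_one hx fun s hs => ?_
          simp only [Finset.mem_insert, Finset.mem_singleton] at hs
          rcases hs with rfl | rfl
          · simp [hij.symm]
          · simpa using fun e => hik e.symm
        have h5 := norm_sub_norm_le (∏ s ∈ Finset.univ.erase i, x s) (x i)
        rw [div_le_iff₀ (by positivity)] at hr
        have h6 : (η ^ 3)⁻¹ + 1 ≤ δ * ‖x j‖ :=
          calc (η ^ 3)⁻¹ + 1 ≤ δ * (m * ρ ^ r) := by linarith
            _ ≤ _ := by gcongr
        have h7 : ((η ^ 3)⁻¹ + 1) * ‖x k‖ ≤ δ * ‖x j‖ * ‖x k‖ := by gcongr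
        have h8 : (η ^ 3)⁻¹ * ‖x i‖ ≤ (η ^ 3)⁻¹ * ‖x k‖ := by gcongr
        have h9 : flipAt i x i = ∏ s ∈ Finset.univ.erase i, x s - x i := by simp [flipAt]
        rw [h9]
        linarith
      have h4 := weight_cons_le (by positivity) (h.ne_zero _) h3
      rwa [inv_inv, cbrt_cube hη0.le] at h4
  refine (Finset.sum_le_sum key).trans ?_
  rw [Finset.sum_add_distrib, Finset.sum_const, nsmul_eq_mul, add_mul]
  refine add_le_add ?_ ?_
  · rw [Finset.sum_ite_eq']
    split_ifs
    · exact le_rfl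
    · positivity
  · rw [← mul_assoc]
    gcongr
    simpa using Finset.card_le_univ (nextLabels (j :: k :: w))

/-- The exponent 1/3 comes from (|x_p||x_q|)³ ≤ (|x_p||x_q||x_j|)² ≤ (δ⁻¹T)², where T = |∏x| and x_j
is the largest coordinate; hence 1/|φ| = |x_p x_q|/T is bounded by a multiple of T^(-1/3). -/
theorem Grows.estimates {a : Fin n → ℂ} {ρ m : ℝ} {N : ℕ} (h : Grows a ρ m N)
    {j : Fin n} {w : List (Fin n)} (hr : Reduced (j :: w)) (hw : N ≤ w.length) :
    ‖∏ k, pathVec a (j :: w) k‖⁻¹ ≤ (m ^ n)⁻¹ * weight a (j :: w) ∧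
    (∀ p q, p ≠ q → p ≠ j → q ≠ j →
      ‖pathVec a (j :: w) p‖ * ‖pathVec a (j :: w) q‖ / ‖∏ k, pathVec a (j :: w) k‖ ≤
        (m ^ n)⁻¹ * weight a (j :: w)) ∧
    (m ^ n)⁻¹ * weight a (j :: w) ≤ (m ^ n)⁻¹ ^ 2 := by
  have hm := h.pos
  have hx := h.lower (j :: w) hr (by simpa using hw)
  have hdom := h.dom w j hr hw
  have hw0 := weight_nonneg a (j :: w)
  have hw3 : weight a (j :: w) ^ 3 = ‖∏ k, pathVec a (j :: w) k‖⁻¹ := cbrt_pow (by positivity)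
  set x := pathVec a (j :: w)
  set t := weight a (j :: w)
  set δ := m ^ n with hδ
  have hδ0 : 0 < δ := by positivity
  have hδ1 : 1 ≤ δ⁻¹ := (one_le_inv₀ hδ0).mpr (pow_le_one₀ hm.le h.le_one)
  have hT : δ ≤ ‖∏ k, x k‖ := by
    rw [norm_prod]; exact pow_le_prod_norm hm h.le_one hx _
  set T := ‖∏ k, x k‖ with hTdef
  have hT0 : 0 < T := hδ0.trans_le hT
  have hTinv : T⁻¹ ≤ δ⁻¹ := inv_anti₀ hδ0 hT
  have hTi0 : 0 < T⁻¹ := inv_pos.mpr hT0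
  refine ⟨?_, fun p q hpq hp hq => ?_, ?_⟩
  · refine le_of_pow_le_pow_left₀ three_ne_zero (by positivity) ?_
    rw [mul_pow, hw3, pow_succ]
    gcongr
    calc T⁻¹ ^ 2 ≤ δ⁻¹ ^ 2 := by gcongr
      _ ≤ δ⁻¹ ^ 3 := pow_le_pow_right₀ hδ1 (by norm_num)
  · refine le_of_pow_le_pow_left₀ three_ne_zero (by positivity) ?_
    rw [mul_pow, hw3]
    have hle : ∀ i, i ≠ j → ‖x i‖ ≤ ‖x j‖ := fun i hi => by
      have := hdom i hi
      have := h.one_lt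
      nlinarith [norm_nonneg (x i)]
    have h1 : δ * (‖x p‖ * ‖x q‖ * ‖x j‖) ≤ T := by
      have e : ∏ k ∈ ({p, q, j} : Finset (Fin n)), ‖x k‖ = ‖x p‖ * ‖x q‖ * ‖x j‖ := by
        rw [Finset.prod_insert (by simp [hpq, hp]), Finset.prod_pair hq, mul_assoc]
      rw [← e, hTdef, norm_prod]
      exact mul_prod_le_prod_norm hm h.le_one hx (Finset.subset_univ _)
    have h2 : (‖x p‖ * ‖x q‖) ^ 3 ≤ (‖x p‖ * ‖x q‖ * ‖x j‖) ^ 2 := by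
      rw [pow_succ, mul_pow _ ‖x j‖, pow_two ‖x j‖]
      gcongr
      · exact hle p hp
      · exact hle q hq
    have h3 : (‖x p‖ * ‖x q‖ * ‖x j‖) ^ 2 ≤ (δ⁻¹ * T) ^ 2 := by
      refine pow_le_pow_left₀ (by positivity) ?_ 2
      rw [← div_eq_inv_mul, le_div_iff₀ hδ0]; linarith
    rw [div_pow, div_le_iff₀ (by positivity)]
    calc _ ≤ (δ⁻¹ * T) ^ 2 := h2.trans h3
      _ = δ⁻¹ ^ 2 * T⁻¹ * T ^ 3 := by field_simp
      _ ≤ δ⁻¹ ^ 3 * T⁻¹ * T ^ 3 := by gcongr; norm_num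
  · rw [pow_two]
    gcongr
    refine le_of_pow_le_pow_left₀ three_ne_zero (by positivity) ?_
    rw [hw3]
    exact hTinv.trans (le_self_pow₀ hδ1 three_ne_zero)

end Estimates

/-! ### Algebraic identities on a single alternating geodesic -/

section Identities

variable {n : ℕ}

/-- The sum of the squares of the coordinates other than the `i`-th and the `j`-th. -/
def coSum (x : Fin n → ℂ) (i j : Fin n) : ℂ := ∑ k ∈ ({i, j} : Finset (Fin n))ᶜ, x k ^ 2

/-- Half of the value of `hfun` at the alternating path through `x` with labels `i`, `j`. -/
noncomputable def halfTerm (x : Fin n → ℂ) (i j : Fin n) : ℂ :=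
  (bigRoot (coProd x i j))⁻¹ / coProd x i j

/-- The sum of the inverses of the products of the coordinates, over the vertices after `x` on the
alternating path that starts at `x` and has the labels `i, j, i, …`. -/
noncomputable def tailSum (x : Fin n → ℂ) (i j : Fin n) : ℂ :=
  (coProd x i j * x j * (bigRoot (coProd x i j) * x j - x i))⁻¹

theorem coSum_sub_hurwitzPoly (x : Fin n → ℂ) {i j : Fin n} (hij : i ≠ j) :
    coSum x i j - hurwitzPoly x = coProd x i j * x i * x j - (x i ^ 2 + x j ^ 2) := by
  rw [hurwitzPoly, sum_sq_eq x hij, prod_eq_coProd x hij, coSum]; ring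

/-- σ - μ is a quadratic form in x_i, x_j that splits over λ; the factors are the growing components
in the two directions of the geodesic. -/
theorem mul_coSum_sub (x : Fin n → ℂ) {i j : Fin n} (hij : i ≠ j) (h : coProd x i j ≠ 0) :
    bigRoot (coProd x i j) * (coSum x i j - hurwitzPoly x) =
      (bigRoot (coProd x i j) * x j - x i) * (bigRoot (coProd x i j) * x i - x j) := by
  have hb := bigRoot_ne_zero h
  have e := bigRoot_add_inv h
  rw [coSum_sub_hurwitzPoly x hij]
  set b := bigRoot (coProd x i j)
  rw [← e]
  field_simp
  ring

theorem halfTerm_flipAt (x : Fin n → ℂ) (i j : Fin n) :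
    halfTerm x i j = halfTerm (flipAt i x) j i := by
  rw [halfTerm, halfTerm, coProd_comm _ j i, coProd_flipAt]

/-- The flip multiplies the growing component by λ, so the closed form telescopes. -/
theorem tailSum_flipAt (x : Fin n → ℂ) {i j : Fin n} (hij : i ≠ j) (h : coProd x i j ≠ 0)
    (hj : x j ≠ 0) (hi : flipAt i x i ≠ 0)
    (hb : bigRoot (coProd x i j) * x j - x i ≠ 0) :
    tailSum x i j = (∏ k, flipAt i x k)⁻¹ + tailSum (flipAt i x) j i := by
  rw [tailSum, tailSum, prod_eq_coProd _ hij, coProd_comm _ j i, coProd_flipAt,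
    flipAt_ne x hij.symm]
  have hb0 := bigRoot_ne_zero h
  have e := bigRoot_add_inv h
  rw [flipAt_self x hij] at hi ⊢
  set φ := coProd x i j
  set b := bigRoot φ
  have e2 : b * (φ * x j - x i) - x j = b * (b * x j - x i) := by
    rw [← e]; field_simp; ring
  have e3 : φ * x j - x i = (x j + b * (b * x j - x i)) / b := by
    rw [← e]; field_simp; ring
  rw [e2]
  set d := b * x j - x i
  rw [e3] at hi ⊢
  have h4 : x j + b * d ≠ 0 := by
    intro h0
    rw [h0, zero_div] at hi
    exact hi rfl
  obtain ⟨s, hs⟩ : ∃ s, s = x j + b * d := ⟨_, rfl⟩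
  rw [← hs] at h4 ⊢
  field_simp
  rw [hs]
  ring

/-- This is the error made when the edge weight x_i²/∏x is replaced by half of h(φ). -/
theorem sq_mul_sub_halfTerm (x : Fin n → ℂ) {i j : Fin n} (hij : i ≠ j) (h : coProd x i j ≠ 0)
    (hj : x j ≠ 0) (hb : bigRoot (coProd x i j) * x j - x i ≠ 0) :
    x i ^ 2 * (∏ k, x k)⁻¹ - halfTerm x i j =
      (coSum x i j - hurwitzPoly x) * tailSum x i j := by
  have e := mul_coSum_sub x hij h
  have hb0 := bigRoot_ne_zero h
  have e' : coSum x i j - hurwitzPoly x = (bigRoot (coProd x i j) * x j - x i) *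
      (bigRoot (coProd x i j) * x i - x j) / bigRoot (coProd x i j) := by
    rw [eq_div_iff hb0, ← e]; ring
  rw [e', halfTerm, tailSum, prod_eq_coProd x hij]
  set φ := coProd x i j
  set b := bigRoot φ
  set d := b * x j - x i
  field_simp

theorem total_eq (x : Fin n → ℂ) {i j : Fin n} (hij : i ≠ j) (h : coProd x i j ≠ 0)
    (hi : x i ≠ 0) (hj : x j ≠ 0) (hb : bigRoot (coProd x i j) * x j - x i ≠ 0)
    (hb' : bigRoot (coProd x i j) * x i - x j ≠ 0) :
    csqrt (1 - 4 / coProd x i j ^ 2) / (coSum x i j - hurwitzPoly x) =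
      (∏ k, x k)⁻¹ + tailSum x i j + tailSum x j i := by
  have e := mul_coSum_sub x hij h
  have hb0 := bigRoot_ne_zero h
  have e' : coSum x i j - hurwitzPoly x = (bigRoot (coProd x i j) * x j - x i) *
      (bigRoot (coProd x i j) * x i - x j) / bigRoot (coProd x i j) := by
    rw [eq_div_iff hb0, ← e]; ring
  rw [e', csqrt_eq_bigRoot h, tailSum, tailSum, prod_eq_coProd x hij, coProd_comm x j i]
  set φ := coProd x i j
  set b := bigRoot φ
  have e1 : (φ * x i * x j)⁻¹ + (φ * x j * (b * x j - x i))⁻¹ + (φ * x i * (b * x i - x j))⁻¹ =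
    ((b * x j - x i) * (b * x i - x j) + x i * (b * x i - x j) + x j * (b * x j - x i)) /
      (φ * x i * x j * ((b * x j - x i) * (b * x i - x j))) := by
    set d := b * x j - x i
    set d' := b * x i - x j
    field_simp
  have e2 : (b * x j - x i) * (b * x i - x j) + x i * (b * x i - x j) + x j * (b * x j - x i) =
      (b ^ 2 - 1) * (x i * x j) := by ring
  rw [e1, e2]
  set d := b * x j - x i
  set d' := b * x i - x j
  field_simp

/-! ### Sums over pairs of labels -/

theorem sum_powersetCard_two {A : Type*} [AddCommMonoid A] {F : Finset (Fin n) → A}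
    {G : Fin n → Fin n → A} (s : Finset (Fin n))
    (h : ∀ i j, i ≠ j → F {i, j} = G i j + G j i) :
    ∑ I ∈ s.powersetCard 2, F I = ∑ j ∈ s, ∑ i ∈ s.erase j, G j i := by
  have hoff : ∑ j ∈ s, ∑ i ∈ s.erase j, G j i = ∑ p ∈ s.offDiag, G p.1 p.2 := by
    rw [Finset.sum_finset_product (s.offDiag) s (fun j => s.erase j)]
    rintro ⟨j, i⟩
    simp only [Finset.mem_offDiag, Finset.mem_erase]
    tauto
  rw [hoff]
  clear hoff
  induction s using Finset.induction_on with
  | empty => rw [Finset.powersetCard_eq_empty.mpr (by simp)]; simp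
  | insert b s hb ih =>
    rw [Finset.powersetCard_succ_insert hb, Finset.sum_union, ih, Finset.offDiag_insert hb,
      Finset.sum_union, Finset.sum_union, Finset.sum_product, Finset.sum_product]
    · rw [add_assoc]
      congr 1
      rw [Finset.sum_singleton]
      simp only [Finset.sum_singleton]
      rw [← Finset.sum_add_distrib, Finset.powersetCard_one, Finset.map_eq_image,
        Finset.image_image, Finset.sum_image]
      · refine Finset.sum_congr rfl fun i hi => ?_
        exact h b i (by rintro rfl; exact hb hi)
      · intro i hi j hj hij
        have h1 : i ∈ ({b, j} : Finset (Fin n)) := by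
          change insert b {i} = insert b {j} at hij
          rw [← hij]; simp
        rcases Finset.mem_insert.mp h1 with rfl | h1
        · exact absurd hi hb
        · exact Finset.mem_singleton.mp h1
    · rw [Finset.disjoint_left]
      rintro ⟨p, q⟩ h1 h2
      simp only [Finset.mem_offDiag, Finset.mem_product, Finset.mem_singleton] at h1 h2
      grind
    · rw [Finset.disjoint_left]
      rintro ⟨p, q⟩ h1 h2
      simp only [Finset.mem_union, Finset.mem_offDiag, Finset.mem_product,
        Finset.mem_singleton] at h1 h2
      grind
    · rw [Finset.disjoint_left]
      rintro I h1 h2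
      obtain ⟨J, -, rfl⟩ := Finset.mem_image.mp h2
      exact hb ((Finset.mem_powersetCard.mp h1).1 (Finset.mem_insert_self b J))

/-! ### Identities for the sums over the reduced words of given length -/

/-- The sum of a quantity over the edges that lead from a non-empty word to longer words. -/
def edgeSum (a : Fin n → ℂ) (G : (Fin n → ℂ) → Fin n → Fin n → ℂ) : List (Fin n) → ℂ
  | [] => 0
  | j :: w => ∑ i ∈ Finset.univ.erase j, G (pathVec a (j :: w)) i j

/-- Moving `G` across the new edge j costs one `R` for each of the n - 1 labels i ≠ j. Among these
i, the last letter of `l` accounts for the edge sum of `l`; the others give pairs of labels rooted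
at `l`. -/
theorem sum_edgeSum_succ {a : Fin n → ℂ} {G : (Fin n → ℂ) → Fin n → Fin n → ℂ}
    {R : (Fin n → ℂ) → ℂ} (h : ∀ l i j, i ≠ j →
      G (pathVec a l) i j = R (pathVec a (i :: l)) + G (pathVec a (i :: l)) j i) (N : ℕ) :
    ∑ l ∈ wordsOf n N, ∑ j ∈ nextLabels l, ∑ i ∈ (nextLabels l).erase j, G (pathVec a l) j i =
      ∑ l ∈ wordsOf n (N + 1), edgeSum a G l - ∑ l ∈ wordsOf n N, edgeSum a G l
        + ((n : ℂ) - 1) * ∑ l ∈ wordsOf n (N + 1), R (pathVec a l) := by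
  rw [sum_wordsOf_succ, sum_wordsOf_succ, Finset.mul_sum, ← Finset.sum_sub_distrib,
    ← Finset.sum_add_distrib]
  refine Finset.sum_congr rfl fun l _ => ?_
  have h1 : ∀ j, edgeSum a G (j :: l) =
      ∑ i ∈ Finset.univ.erase j, G (pathVec a l) j i - ((n : ℂ) - 1) * R (pathVec a (j :: l)) := by
    intro j
    have hcard : ((Finset.univ.erase j).card : ℂ) = (n : ℂ) - 1 := by
      rw [Finset.card_erase_of_mem (Finset.mem_univ j), Finset.card_univ, Fintype.card_fin,
        Nat.cast_sub (by have := j.isLt; omega)]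
      simp
    rw [edgeSum, ← hcard, ← nsmul_eq_mul, ← Finset.sum_const, ← Finset.sum_sub_distrib]
    refine Finset.sum_congr rfl fun i hi => ?_
    rw [h l j i (Finset.ne_of_mem_erase hi).symm]; ring
  simp only [h1, Finset.sum_sub_distrib, ← Finset.mul_sum]
  cases l with
  | nil => simp [nextLabels_nil, edgeSum]
  | cons k w =>
    rw [nextLabels_cons, edgeSum]
    have h2 : ∀ j ∈ Finset.univ.erase k, ∑ i ∈ Finset.univ.erase j, G (pathVec a (k :: w)) j i =
        G (pathVec a (k :: w)) j k +
          ∑ i ∈ (Finset.univ.erase k).erase j, G (pathVec a (k :: w)) j i := by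
      intro j hj
      rw [Finset.erase_right_comm]
      exact (Finset.add_sum_erase _ (fun i => G (pathVec a (k :: w)) j i)
        (Finset.mem_erase.mpr ⟨(Finset.ne_of_mem_erase hj).symm, Finset.mem_univ k⟩)).symm
    rw [Finset.sum_congr rfl h2, Finset.sum_add_distrib]
    ring

theorem sum_sq_edges {a : Fin n → ℂ} (hn : 2 ≤ n) (h0 : ∀ l k, pathVec a l k ≠ 0) (N : ℕ) :
    ∑ l ∈ wordsOf n N, ∑ i ∈ nextLabels l, pathVec a l i ^ 2 * (∏ k, pathVec a l k)⁻¹ =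
      1 + hurwitzPoly a *
        ∑ M ∈ Finset.range (N + 1), ∑ l ∈ wordsOf n M, (∏ k, pathVec a l k)⁻¹ := by
  have hp : ∀ l, ∏ k, pathVec a l k ≠ 0 := fun l => Finset.prod_ne_zero_iff.mpr fun k _ => h0 l k
  have hvert : ∀ l, ∑ i, pathVec a l i ^ 2 * (∏ k, pathVec a l k)⁻¹ =
      1 + hurwitzPoly a * (∏ k, pathVec a l k)⁻¹ := by
    intro l
    have := hp l
    rw [← Finset.sum_mul, ← hurwitzPoly_pathVec hn a l, hurwitzPoly]
    field_simp
    ring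
  induction N with
  | zero =>
    rw [sum_wordsOf_zero, nextLabels_nil, hvert, Finset.sum_range_one, sum_wordsOf_zero]
  | succ N ih =>
    rw [Finset.sum_range_succ, mul_add, ← add_assoc, ← ih, sum_wordsOf_succ, sum_wordsOf_succ,
      Finset.mul_sum, ← Finset.sum_add_distrib]
    refine Finset.sum_congr rfl fun l _ => ?_
    rw [Finset.mul_sum, ← Finset.sum_add_distrib]
    refine Finset.sum_congr rfl fun j _ => ?_
    have hsplit := Finset.add_sum_erase Finset.univ
      (fun i => pathVec a (j :: l) i ^ 2 * (∏ k, pathVec a (j :: l) k)⁻¹) (Finset.mem_univ j)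
    rw [hvert] at hsplit
    -- If P is the product of the other coordinates, the two weights are x_j/P and x_j'/P, and x_j +
    -- x_j' = P.
    have hedge : pathVec a (j :: l) j ^ 2 * (∏ k, pathVec a (j :: l) k)⁻¹ =
        1 - pathVec a l j ^ 2 * (∏ k, pathVec a l k)⁻¹ := by
      have : Nontrivial (Fin n) := Fin.nontrivial_iff_two_le.mpr hn
      obtain ⟨i, hi⟩ := exists_ne j
      have h1 := hp l
      have h2 := hp (j :: l)
      have h3 := h0 (j :: l) j
      have h4 := h0 l j
      rw [prod_eq_coProd _ hi.symm] at h1 h2 ⊢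
      rw [prod_eq_coProd _ hi.symm]
      rw [pathVec_cons, coProd_flipAt, flipAt_ne _ hi] at h2 ⊢
      have h5 : pathVec a (j :: l) j = coProd (pathVec a l) j i * pathVec a l i - pathVec a l j :=
        flipAt_self _ hi.symm
      rw [← pathVec_cons]
      have h6 : coProd (pathVec a l) j i * pathVec a l i ≠ 0 := by
        intro e; apply h1; linear_combination pathVec a l j * e
      have h7 := left_ne_zero_of_mul h6
      have h8 := right_ne_zero_of_mul h6
      field_simp
      rw [h5]
    rw [nextLabels_cons]
    linear_combination hsplit - hedge

end Identities

/-! ### Evaluation of the two series over geodesics -/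

section Sums

variable {n : ℕ} {a : Fin n → ℂ} {ε K ρ m : ℝ} {N : ℕ}

theorem Grows.summable_inv_prod (h : Grows a ρ m N) :
    Summable fun l : {l : List (Fin n) // Reduced l} => (∏ k, pathVec a l.1 k)⁻¹ := by
  refine Summable.of_norm_bounded_eventually (h.summable_weight.mul_left (m ^ n)⁻¹) ?_
  filter_upwards [(finite_short_words (N + 1)).compl_mem_cofinite] with l hl
  obtain ⟨_ | ⟨j, w⟩, hr⟩ := l
  · simp at hl
  · have hw : N ≤ w.length := by
      by_contra hlt
      exact hl (show (j :: w).length < N + 1 by simp; omega)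
    rw [norm_inv]
    exact (h.estimates hr hw).1

theorem Grows.tendsto_edgeSum (h : Grows a ρ m N) {G : (Fin n → ℂ) → Fin n → Fin n → ℂ} {C : ℝ}
    (hG : ∀ j w i, Reduced (j :: w) → N ≤ w.length → i ≠ j →
      ‖G (pathVec a (j :: w)) i j‖ ≤ C * weight a (j :: w)) :
    Tendsto (fun M => ∑ l ∈ wordsOf n M, edgeSum a G l) atTop (𝓝 0) := by
  refine tendsto_level_zero ?_
  refine Summable.of_norm_bounded_eventually (h.summable_weight.mul_left (n * |C|)) ?_
  filter_upwards [(finite_short_words (N + 1)).compl_mem_cofinite] with l hl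
  obtain ⟨_ | ⟨j, w⟩, hr⟩ := l
  · simp at hl
  · have hw : N ≤ w.length := by
      by_contra hlt
      exact hl (show (j :: w).length < N + 1 by simp; omega)
    have hw0 := weight_nonneg a (j :: w)
    change ‖edgeSum a G (j :: w)‖ ≤ n * |C| * weight a (j :: w)
    calc ‖edgeSum a G (j :: w)‖ ≤ ∑ i ∈ Finset.univ.erase j, |C| * weight a (j :: w) := by
          refine norm_sum_le_of_le _ fun i hi => ?_
          refine (hG j w i hr hw (Finset.ne_of_mem_erase hi)).trans ?_
          gcongr
          exact le_abs_self C
      _ = (Finset.univ.erase j).card * (|C| * weight a (j :: w)) := by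
          rw [Finset.sum_const, nsmul_eq_mul]
      _ ≤ n * (|C| * weight a (j :: w)) := by
          gcongr
          simp
      _ = _ := by ring

theorem Tame.norm_tailSum_le (h : Tame a ε K) (hg : Grows a ρ m N) {j i : Fin n}
    {w : List (Fin n)} (hr : Reduced (j :: w)) (hw : N ≤ w.length) (hij : i ≠ j) :
    ‖tailSum (pathVec a (j :: w)) i j‖ ≤ ρ / (ρ - 1) *
      (‖pathVec a (j :: w) i‖ / ‖pathVec a (j :: w) j‖) * ‖∏ k, pathVec a (j :: w) k‖⁻¹ := by
  have hdom := hg.dom w j hr hw i hij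
  have hi : 0 < ‖pathVec a (j :: w) i‖ := norm_pos_iff.mpr (h.ne_zero _ i)
  have hj : 0 < ‖pathVec a (j :: w) j‖ := norm_pos_iff.mpr (h.ne_zero _ j)
  have hφ : 0 < ‖coProd (pathVec a (j :: w)) i j‖ := norm_pos_iff.mpr (h.coProd_ne_zero _ hij)
  have hb := one_lt_norm_bigRoot (h.notMem_seg (j :: w) i j hij)
  rw [tailSum, prod_eq_coProd _ hij]
  set x := pathVec a (j :: w)
  set φ := coProd x i j
  have hρ := hg.one_lt
  have hρ1 : 0 < ρ - 1 := by linarith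
  have hD : (ρ - 1) / ρ * ‖x j‖ ≤ ‖bigRoot φ * x j - x i‖ := by
    have h1 := norm_sub_norm_le (bigRoot φ * x j) (x i)
    rw [norm_mul] at h1
    have h2 : ‖x i‖ ≤ ‖x j‖ / ρ := by rw [le_div_iff₀ (by linarith)]; linarith
    have h3 : (ρ - 1) / ρ * ‖x j‖ = ‖x j‖ - ‖x j‖ / ρ := by field_simp
    nlinarith
  have hD0 : 0 < (ρ - 1) / ρ * ‖x j‖ := by positivity
  rw [norm_inv, norm_mul, norm_mul, norm_mul, norm_mul]
  calc (‖φ‖ * ‖x j‖ * ‖bigRoot φ * x j - x i‖)⁻¹ ≤ (‖φ‖ * ‖x j‖ * ((ρ - 1) / ρ * ‖x j‖))⁻¹ := by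
        gcongr
    _ = _ := by field_simp

/-- From h = 2λ⁻¹/φ and |λ⁻¹| ≤ 2/|φ| comes |h| ≤ 4/|φ|²; one factor 1/|φ| supplies the weight and
the other is merely bounded. -/
theorem Tame.norm_hfun_le (h : Tame a ε K) (hg : Grows a ρ m N) {I : Finset (Fin n)}
    {l : List (Fin n)} (hI : I.card = 2) (hl : Reduced l) (hlen : N + 1 ≤ l.length)
    (hsub : I ⊆ nextLabels l) :
    ‖hfun (∏ k ∈ Iᶜ, pathVec a l k)‖ ≤ 4 * (m ^ n)⁻¹ ^ 3 * weight a l := by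
  have hm := hg.pos
  set c : ℝ := (m ^ n)⁻¹ with hc
  have hc0 : 0 < c := by positivity
  obtain ⟨p, q, hpq, rfl⟩ := Finset.card_eq_two.mp hI
  rcases l with _ | ⟨j, w⟩
  · simp at hlen
  have hw : N ≤ w.length := by simpa using hlen
  have hp : p ≠ j := by
    have := hsub (Finset.mem_insert_self p _)
    rw [nextLabels_cons] at this; exact Finset.ne_of_mem_erase this
  have hq : q ≠ j := by
    have := hsub (Finset.mem_insert_of_mem (Finset.mem_singleton_self q))
    rw [nextLabels_cons] at this; exact Finset.ne_of_mem_erase this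
  obtain ⟨-, h2, h3⟩ := hg.estimates hl hw
  have h2 := h2 p q hpq hp hq
  have hseg := h.notMem_seg (j :: w) p q hpq
  have hφ0 := ne_zero_of_notMem_seg hseg
  have hxp : ‖pathVec a (j :: w) p‖ ≠ 0 := norm_ne_zero_iff.mpr (h.ne_zero _ p)
  have hxq : ‖pathVec a (j :: w) q‖ ≠ 0 := norm_ne_zero_iff.mpr (h.ne_zero _ q)
  have ht := weight_nonneg a (j :: w)
  rw [prod_eq_coProd _ hpq, norm_mul, norm_mul] at h2
  change ‖hfun (coProd (pathVec a (j :: w)) p q)‖ ≤ 4 * c ^ 3 * weight a (j :: w)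
  have hb := norm_bigRoot_inv_le hseg
  rw [hfun_eq_bigRoot hφ0, norm_mul, norm_div, Complex.norm_ofNat]
  set φ := coProd (pathVec a (j :: w)) p q
  have hφpos : 0 < ‖φ‖ := norm_pos_iff.mpr hφ0
  have h4 : ‖φ‖⁻¹ ≤ c * weight a (j :: w) := by
    refine le_of_eq_of_le ?_ h2
    field_simp
  calc 2 * (‖(bigRoot φ)⁻¹‖ / ‖φ‖) ≤ 2 * (2 / ‖φ‖ / ‖φ‖) := by gcongr
    _ = 4 * (‖φ‖⁻¹ * ‖φ‖⁻¹) := by field_simp; norm_num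
    _ ≤ 4 * ((c * weight a (j :: w)) * c ^ 2) := by
        gcongr
        exact h4.trans h3
    _ = _ := by ring
theorem Tame.sum_hfun_level (h : Tame a ε K) (M : ℕ) :
    ∑ l ∈ wordsOf n M, ∑ I ∈ (nextLabels l).powersetCard 2, hfun (∏ k ∈ Iᶜ, pathVec a l k) =
      ∑ l ∈ wordsOf n (M + 1), edgeSum a halfTerm l - ∑ l ∈ wordsOf n M, edgeSum a halfTerm l := by
  -- The half terms are constant along a geodesic, so crossing an edge costs nothing.
  have h1 := sum_edgeSum_succ (a := a) (G := halfTerm) (R := fun _ => 0)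
    (fun l i j _ => by rw [zero_add, pathVec_cons, ← halfTerm_flipAt]) M
  simp only [Finset.sum_const_zero, mul_zero, add_zero] at h1
  rw [← h1]
  refine Finset.sum_congr rfl fun l _ => ?_
  refine sum_powersetCard_two (F := fun I => hfun (∏ k ∈ Iᶜ, pathVec a l k)) _
    fun i j hij => ?_
  change hfun (coProd (pathVec a l) i j) = _
  rw [hfun_eq_bigRoot (h.coProd_ne_zero l hij), halfTerm, halfTerm,
    coProd_comm (pathVec a l) j i]
  ring
theorem Tame.norm_coSum_sub_mul_tailSum_le (h : Tame a ε K) (hg : Grows a ρ m N) (j : Fin n)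
    (w : List (Fin n)) (i : Fin n) (hr : Reduced (j :: w)) (hw : N ≤ w.length) (hij : i ≠ j) :
    ‖(coSum (pathVec a (j :: w)) i j - hurwitzPoly a) * tailSum (pathVec a (j :: w)) i j‖ ≤
      ρ / (ρ - 1) * ((n + ‖hurwitzPoly a‖) * (m ^ n)⁻¹) * weight a (j :: w) := by
  have hρ := hg.one_lt
  have hm := hg.pos
  set c : ℝ := (m ^ n)⁻¹ with hc
  have hc0 : 0 < c := by positivity
  have ht := h.norm_tailSum_le hg hr hw hij
  obtain ⟨e1, e2, -⟩ := hg.estimates hr hw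
  have hdom := hg.dom w j hr hw
  have hi : 0 < ‖pathVec a (j :: w) i‖ := norm_pos_iff.mpr (h.ne_zero _ i)
  have hj : 0 < ‖pathVec a (j :: w) j‖ := norm_pos_iff.mpr (h.ne_zero _ j)
  have hwt := weight_nonneg a (j :: w)
  set x := pathVec a (j :: w)
  have hle : ∀ k, k ≠ j → ‖x k‖ ≤ ‖x j‖ := fun k hk => by
    have := hdom k hk
    nlinarith [norm_nonneg (x k)]
  set T := ‖∏ k, x k‖
  have hT0 : 0 ≤ T⁻¹ := inv_nonneg.mpr (norm_nonneg _)
  have hratio : ‖x i‖ / ‖x j‖ ≤ 1 := (div_le_one hj).mpr (hle i hij)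
  have hsum : ‖coSum x i j‖ * (‖x i‖ / ‖x j‖ * T⁻¹) ≤ n * (c * weight a (j :: w)) := by
    have h1 : ‖coSum x i j‖ ≤ ∑ k ∈ ({i, j} : Finset (Fin n))ᶜ, ‖x k‖ ^ 2 :=
      norm_sum_le_of_le _ fun k _ => (norm_pow _ _).le
    calc _ ≤ (∑ k ∈ ({i, j} : Finset (Fin n))ᶜ, ‖x k‖ ^ 2) * (‖x i‖ / ‖x j‖ * T⁻¹) := by
          gcongr
      _ = ∑ k ∈ ({i, j} : Finset (Fin n))ᶜ, ‖x k‖ ^ 2 * (‖x i‖ / ‖x j‖ * T⁻¹) :=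
          Finset.sum_mul _ _ _
      _ ≤ ∑ k ∈ ({i, j} : Finset (Fin n))ᶜ, c * weight a (j :: w) := by
          refine Finset.sum_le_sum fun k hk => ?_
          simp only [Finset.mem_compl, Finset.mem_insert, Finset.mem_singleton, not_or] at hk
          refine le_trans ?_ (e2 k i hk.1 hk.2 hij)
          -- The ratio |x_i|/|x_j| from the tail turns |x_k|² into at most |x_k||x_i|, a product of
          -- two non-dominant coordinates.
          have h2 : ‖x k‖ / ‖x j‖ ≤ 1 := (div_le_one hj).mpr (hle k hk.2)
          calc ‖x k‖ ^ 2 * (‖x i‖ / ‖x j‖ * T⁻¹)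
              = ‖x k‖ / ‖x j‖ * (‖x k‖ * ‖x i‖ * T⁻¹) := by ring
            _ ≤ 1 * (‖x k‖ * ‖x i‖ * T⁻¹) := by gcongr
            _ = _ := by rw [one_mul, div_eq_mul_inv]
      _ = (({i, j} : Finset (Fin n))ᶜ.card : ℝ) * (c * weight a (j :: w)) := by
          rw [Finset.sum_const, nsmul_eq_mul]
      _ ≤ _ := by
          gcongr
          simpa using Finset.card_le_univ ({i, j} : Finset (Fin n))ᶜ
  have hmu : ‖hurwitzPoly a‖ * (‖x i‖ / ‖x j‖ * T⁻¹) ≤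
      ‖hurwitzPoly a‖ * (c * weight a (j :: w)) := by
    refine mul_le_mul_of_nonneg_left ?_ (norm_nonneg _)
    calc _ ≤ 1 * T⁻¹ := by gcongr
      _ ≤ _ := by rw [one_mul]; exact e1
  have hρ0 : 0 ≤ ρ / (ρ - 1) := div_nonneg (by linarith) (by linarith)
  rw [norm_mul]
  calc _ ≤ (‖coSum x i j‖ + ‖hurwitzPoly a‖) * (ρ / (ρ - 1) * (‖x i‖ / ‖x j‖) * T⁻¹) := by
        gcongr
        exact norm_sub_le _ _
    _ = ρ / (ρ - 1) * (‖coSum x i j‖ * (‖x i‖ / ‖x j‖ * T⁻¹) +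
          ‖hurwitzPoly a‖ * (‖x i‖ / ‖x j‖ * T⁻¹)) := by ring
    _ ≤ ρ / (ρ - 1) * (n * (c * weight a (j :: w)) +
          ‖hurwitzPoly a‖ * (c * weight a (j :: w))) := by gcongr
    _ = _ := by ring
theorem Tame.sum_halfTerm_level (h : Tame a ε K) {M : ℕ} (hM : 1 ≤ M) :
    ∑ l ∈ wordsOf n M, edgeSum a halfTerm l =
      1 + hurwitzPoly a *
        ∑ M ∈ Finset.range (M + 1), ∑ l ∈ wordsOf n M, (∏ k, pathVec a l k)⁻¹ -
      ∑ l ∈ wordsOf n M, edgeSum a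
        (fun x i j => (coSum x i j - hurwitzPoly a) * tailSum x i j) l := by
  have hn : 2 ≤ n := by have := h.three_le; omega
  rw [← sum_sq_edges hn h.ne_zero, ← Finset.sum_sub_distrib]
  refine Finset.sum_congr rfl fun l hl => ?_
  rcases l with _ | ⟨j, w⟩
  -- The empty word is excluded because its edge sum is 0 by convention, although all its edges are
  -- outgoing.
  · have := (mem_wordsOf.mp hl).2
    simp at this; omega
  rw [edgeSum, edgeSum, nextLabels_cons, ← Finset.sum_sub_distrib]
  refine Finset.sum_congr rfl fun i hi => ?_
  have hij := Finset.ne_of_mem_erase hi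
  rw [← hurwitzPoly_pathVec hn a (j :: w), ← sq_mul_sub_halfTerm _ hij
    (h.coProd_ne_zero _ hij) (h.ne_zero _ j) (h.growing_ne_zero _ hij)]
  ring

theorem Tame.hasSum_hfun (h : Tame a ε K) (hg : Grows a ρ m N) :
    HasSum (fun r : Root n => hfun (∏ k ∈ r.1.1.1ᶜ, pathVec a r.1.2.1 k))
      (1 + hurwitzPoly a * ∑' l : {l : List (Fin n) // Reduced l}, (∏ k, pathVec a l.1 k)⁻¹) := by
  refine hasSum_root (F := fun I l => hfun (∏ k ∈ Iᶜ, pathVec a l k))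
    (hg.summable_weight.mul_left _) (fun I l => h.norm_hfun_le hg) ?_
  have herr := hg.tendsto_edgeSum
    (G := fun x i j => (coSum x i j - hurwitzPoly a) * tailSum x i j)
    (h.norm_coSum_sub_mul_tailSum_le hg)
  have hV := HasSum.tendsto_levels (f := fun l => (∏ k, pathVec a l k)⁻¹)
    hg.summable_inv_prod.hasSum
  have hlim := (((hV.comp (tendsto_add_atTop_nat 1)).const_mul (hurwitzPoly a)).const_add
    1).sub herr
  rw [sub_zero] at hlim
  refine hlim.congr' ?_
  filter_upwards [eventually_ge_atTop 1] with M hM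
  rw [Finset.sum_congr rfl fun N _ => h.sum_hfun_level N, Finset.sum_range_sub (fun N => ∑ l ∈ wordsOf n N, edgeSum a halfTerm l), sum_wordsOf_zero, edgeSum,
    sub_zero, h.sum_halfTerm_level hM]
  rfl

theorem Tame.csqrt_div_eq (h : Tame a ε K) (l : List (Fin n)) {i j : Fin n} (hij : i ≠ j) :
    csqrt (1 - 4 / coProd (pathVec a l) i j ^ 2) /
      (coSum (pathVec a l) i j - hurwitzPoly a) =
      (∏ k, pathVec a l k)⁻¹ + tailSum (pathVec a l) i j + tailSum (pathVec a l) j i := by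
  have hn : 2 ≤ n := by have := h.three_le; omega
  rw [← hurwitzPoly_pathVec hn a l]
  refine total_eq _ hij (h.coProd_ne_zero _ hij) (h.ne_zero _ i) (h.ne_zero _ j)
    (h.growing_ne_zero _ hij) ?_
  rw [coProd_comm]
  exact h.growing_ne_zero _ hij.symm
theorem Tame.tailSum_step (h : Tame a ε K) (l : List (Fin n)) (i j : Fin n) (hij : i ≠ j) :
    tailSum (pathVec a l) i j =
      (∏ k, pathVec a (i :: l) k)⁻¹ + tailSum (pathVec a (i :: l)) j i :=
  tailSum_flipAt _ hij (h.coProd_ne_zero _ hij) (h.ne_zero _ j) (h.ne_zero (i :: l) i)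
    (h.growing_ne_zero _ hij)

theorem Tame.norm_tailSum_le_inv (h : Tame a ε K) (hg : Grows a ρ m N) {j : Fin n}
    {w : List (Fin n)} {i : Fin n} (hr : Reduced (j :: w)) (hw : N ≤ w.length) (hij : i ≠ j) :
    ‖tailSum (pathVec a (j :: w)) i j‖ ≤ ρ / (ρ - 1) * ‖∏ k, pathVec a (j :: w) k‖⁻¹ := by
  have hρ := hg.one_lt
  have hρ0 : 0 ≤ ρ / (ρ - 1) := div_nonneg (by linarith) (by linarith)
  refine (h.norm_tailSum_le hg hr hw hij).trans ?_
  have hj : 0 < ‖pathVec a (j :: w) j‖ := norm_pos_iff.mpr (h.ne_zero _ j)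
  have hratio : ‖pathVec a (j :: w) i‖ / ‖pathVec a (j :: w) j‖ ≤ 1 := by
    rw [div_le_one hj]
    have := hg.dom w j hr hw i hij
    nlinarith [norm_nonneg (pathVec a (j :: w) i)]
  gcongr
  exact mul_le_of_le_one_right hρ0 hratio

theorem Tame.norm_csqrt_div_le (h : Tame a ε K) (hg : Grows a ρ m N) {I : Finset (Fin n)}
    {l : List (Fin n)} (hI : I.card = 2) (hl : Reduced l) (hlen : N + 1 ≤ l.length)
    (hsub : I ⊆ nextLabels l) :
    ‖csqrt (1 - 4 / (∏ k ∈ Iᶜ, pathVec a l k) ^ 2) /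
      (∑ k ∈ Iᶜ, pathVec a l k ^ 2 - hurwitzPoly a)‖ ≤
      (3 + 2 * (ρ / (ρ - 1))) * (m ^ n)⁻¹ * weight a l := by
  have hρ := hg.one_lt
  have hρ0 : 0 ≤ ρ / (ρ - 1) := div_nonneg (by linarith) (by linarith)
  obtain ⟨p, q, hpq, rfl⟩ := Finset.card_eq_two.mp hI
  rcases l with _ | ⟨j, w⟩
  · simp at hlen
  have hw : N ≤ w.length := by simpa using hlen
  have hp := hsub (Finset.mem_insert_self p _)
  have hq := hsub (Finset.mem_insert_of_mem (Finset.mem_singleton_self q))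
  change ‖csqrt (1 - 4 / coProd (pathVec a (j :: w)) p q ^ 2) /
    (coSum (pathVec a (j :: w)) p q - hurwitzPoly a)‖ ≤ _
  rw [h.csqrt_div_eq _ hpq]
  have hT0 : 0 < ‖∏ k, pathVec a (j :: w) k‖ :=
    norm_pos_iff.mpr (Finset.prod_ne_zero_iff.mpr fun k _ => h.ne_zero _ k)
  -- The tail bound needs the last letter among the two labels, so each tail is first advanced by
  -- one step.
  have hbound : ∀ r s, r ∈ nextLabels (j :: w) → r ≠ s →
      ‖tailSum (pathVec a (j :: w)) r s‖ ≤
        (1 + ρ / (ρ - 1)) * ‖∏ k, pathVec a (j :: w) k‖⁻¹ := by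
    intro r s hr hrs
    have hred : Reduced (r :: j :: w) := reduced_cons.mpr ⟨hr, hl⟩
    have h1 := h.norm_tailSum_le_inv hg (w := j :: w) hred (by simp; omega) hrs.symm
    have h2 : ‖∏ k, pathVec a (r :: j :: w) k‖⁻¹ ≤ ‖∏ k, pathVec a (j :: w) k‖⁻¹ :=
      inv_anti₀ hT0 (hg.norm_prod_le hred hw)
    rw [h.tailSum_step _ _ _ hrs]
    calc _ ≤ ‖∏ k, pathVec a (r :: j :: w) k‖⁻¹ +
          ρ / (ρ - 1) * ‖∏ k, pathVec a (r :: j :: w) k‖⁻¹ :=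
          (norm_add_le _ _).trans (add_le_add (norm_inv _).le h1)
      _ = (1 + ρ / (ρ - 1)) * ‖∏ k, pathVec a (r :: j :: w) k‖⁻¹ := by ring
      _ ≤ _ := by gcongr
  calc _ ≤ ‖∏ k, pathVec a (j :: w) k‖⁻¹ +
        (1 + ρ / (ρ - 1)) * ‖∏ k, pathVec a (j :: w) k‖⁻¹ +
        (1 + ρ / (ρ - 1)) * ‖∏ k, pathVec a (j :: w) k‖⁻¹ :=
        (norm_add₃_le).trans
          (add_le_add (add_le_add (norm_inv _).le (hbound p q hp hpq)) (hbound q p hq hpq.symm))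
    _ = (3 + 2 * (ρ / (ρ - 1))) * ‖∏ k, pathVec a (j :: w) k‖⁻¹ := by ring
    _ ≤ (3 + 2 * (ρ / (ρ - 1))) * ((m ^ n)⁻¹ * weight a (j :: w)) := by
        gcongr
        exact (hg.estimates hl hw).1
    _ = _ := by ring

theorem Tame.sum_csqrt_div_level (h : Tame a ε K) (M : ℕ) :
    ∑ l ∈ wordsOf n M, ∑ I ∈ (nextLabels l).powersetCard 2,
      csqrt (1 - 4 / (∏ k ∈ Iᶜ, pathVec a l k) ^ 2) /
        (∑ k ∈ Iᶜ, pathVec a l k ^ 2 - hurwitzPoly a) =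
    ∑ l ∈ wordsOf n (M + 1), edgeSum a tailSum l - ∑ l ∈ wordsOf n M, edgeSum a tailSum l +
      ((n : ℂ) - 1) * ∑ l ∈ wordsOf n (M + 1), (∏ k, pathVec a l k)⁻¹ +
      ∑ l ∈ wordsOf n M, ((nextLabels l).card : ℂ) * (((nextLabels l).card : ℂ) - 1) / 2 *
        (∏ k, pathVec a l k)⁻¹ := by
  have h1 := sum_edgeSum_succ (a := a) (G := tailSum) (R := fun x => (∏ k, x k)⁻¹) h.tailSum_step M
  rw [← h1, ← Finset.sum_add_distrib]
  refine Finset.sum_congr rfl fun l _ => ?_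
  -- The term of the root vertex is split evenly between the two directions of the geodesic.
  rw [sum_powersetCard_two (G := fun i j => tailSum (pathVec a l) i j +
    (∏ k, pathVec a l k)⁻¹ / 2) _ (fun i j hij => ?_)]
  · simp only [Finset.sum_add_distrib, Finset.sum_const, nsmul_eq_mul]
    congr 1
    have h2 : ∀ j ∈ nextLabels l, (((nextLabels l).erase j).card : ℂ) *
        ((∏ k, pathVec a l k)⁻¹ / 2) =
        (((nextLabels l).card : ℂ) - 1) * ((∏ k, pathVec a l k)⁻¹ / 2) := by
      intro j hj
      rw [Finset.card_erase_of_mem hj, Nat.cast_sub (Finset.card_pos.mpr ⟨j, hj⟩),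
        Nat.cast_one]
    rw [Finset.sum_congr rfl h2, Finset.sum_const, nsmul_eq_mul]
    ring
  · change csqrt (1 - 4 / coProd (pathVec a l) i j ^ 2) /
      (coSum (pathVec a l) i j - hurwitzPoly a) = _
    rw [h.csqrt_div_eq l hij]; ring

theorem sum_card_nextLabels (a : Fin n → ℂ) (M : ℕ) : ∑ l ∈ wordsOf n (M + 1),
    ((nextLabels l).card : ℂ) * (((nextLabels l).card : ℂ) - 1) / 2 * (∏ k, pathVec a l k)⁻¹ =
      ((n : ℂ) - 1) * ((n : ℂ) - 2) / 2 * ∑ l ∈ wordsOf n (M + 1), (∏ k, pathVec a l k)⁻¹ := by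
  rw [Finset.mul_sum]
  refine Finset.sum_congr rfl fun l hl => ?_
  rcases l with _ | ⟨j, w⟩
  · have := (mem_wordsOf.mp hl).2
    simp at this
  rw [nextLabels_cons, Finset.card_erase_of_mem (Finset.mem_univ j), Finset.card_univ,
    Fintype.card_fin, Nat.cast_sub (by have := j.isLt; omega), Nat.cast_one]
  ring

/-- A non-empty word lies on n - 1 geodesics through its last edge and is the root of (n-1)(n-2)/2
others; the empty word is the root of all n(n-1)/2, the same total. -/
theorem Tame.sum_csqrt_div_ball (h : Tame a ε K) (M : ℕ) :
    ∑ N ∈ Finset.range (M + 1), ∑ l ∈ wordsOf n N, ∑ I ∈ (nextLabels l).powersetCard 2,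
      csqrt (1 - 4 / (∏ k ∈ Iᶜ, pathVec a l k) ^ 2) /
        (∑ k ∈ Iᶜ, pathVec a l k ^ 2 - hurwitzPoly a) =
    ∑ l ∈ wordsOf n (M + 1), edgeSum a tailSum l +
      ((n : ℂ) - 1) * ∑ N ∈ Finset.range (M + 2), ∑ l ∈ wordsOf n N, (∏ k, pathVec a l k)⁻¹ +
      ((n : ℂ) - 1) * ((n : ℂ) - 2) / 2 *
        ∑ N ∈ Finset.range (M + 1), ∑ l ∈ wordsOf n N, (∏ k, pathVec a l k)⁻¹ := by
  induction M with
  | zero =>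
    simp only [zero_add, Finset.sum_range_succ, Finset.sum_range_zero,
      h.sum_csqrt_div_level, sum_wordsOf_zero, nextLabels_nil, edgeSum, Finset.card_univ,
      Fintype.card_fin]
    ring
  | succ M ih =>
    rw [Finset.sum_range_succ, ih, h.sum_csqrt_div_level, sum_card_nextLabels,
      Finset.sum_range_succ _ (M + 2), Finset.sum_range_succ _ (M + 1)]
    ring

theorem Tame.hasSum_csqrt_div (h : Tame a ε K) (hg : Grows a ρ m N) :
    HasSum (fun r : Root n => csqrt (1 - 4 / (∏ k ∈ r.1.1.1ᶜ, pathVec a r.1.2.1 k) ^ 2) /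
        (∑ k ∈ r.1.1.1ᶜ, pathVec a r.1.2.1 k ^ 2 - hurwitzPoly a))
      ((n : ℂ) * ((n : ℂ) - 1) / 2 *
        ∑' l : {l : List (Fin n) // Reduced l}, (∏ k, pathVec a l.1 k)⁻¹) := by
  refine hasSum_root (F := fun I l => csqrt (1 - 4 / (∏ k ∈ Iᶜ, pathVec a l k) ^ 2) /
        (∑ k ∈ Iᶜ, pathVec a l k ^ 2 - hurwitzPoly a))
    (hg.summable_weight.mul_left _) (fun I l => h.norm_csqrt_div_le hg) ?_
  have hE : Tendsto (fun M => ∑ l ∈ wordsOf n M, edgeSum a tailSum l) atTop (𝓝 0) := by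
    have hρ := hg.one_lt
    have hρ0 : 0 ≤ ρ / (ρ - 1) := div_nonneg (by linarith) (by linarith)
    refine hg.tendsto_edgeSum (C := ρ / (ρ - 1) * (m ^ n)⁻¹) fun j w i hr hw hij => ?_
    refine (h.norm_tailSum_le_inv hg hr hw hij).trans ?_
    rw [mul_assoc]
    gcongr
    exact (hg.estimates hr hw).1
  have hV := HasSum.tendsto_levels (f := fun l => (∏ k, pathVec a l k)⁻¹)
    hg.summable_inv_prod.hasSum
  rw [← tendsto_add_atTop_iff_nat 1]
  simp only [h.sum_csqrt_div_ball]
  have hlim := ((hE.comp (tendsto_add_atTop_nat 1)).add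
    ((hV.comp (tendsto_add_atTop_nat 2)).const_mul ((n : ℂ) - 1))).add
    ((hV.comp (tendsto_add_atTop_nat 1)).const_mul (((n : ℂ) - 1) * ((n : ℂ) - 2) / 2))
  refine Eq.mp (congrArg (fun z => Tendsto _ _ (𝓝 z)) ?_) hlim
  ring

end Sums

/-! ### From the domain 𝒟 to the growth conditions -/

section Domain

variable {n : ℕ}

theorem mem_of_length_dropWhile_le (f : ℕ → Fin n) (I : Finset (Fin n)) (m k : ℕ) (hk : k < m)
    (h : ((extendBy f [] m).dropWhile (· ∈ I)).length ≤ k) : f k ∈ I := by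
  induction m with
  | zero => omega
  | succ m ih =>
    rw [extendBy] at h
    by_cases hm : f m ∈ I
    · rw [List.dropWhile_cons_of_pos (by simpa using hm)] at h
      rcases Nat.lt_succ_iff_lt_or_eq.mp hk with hlt | rfl
      · exact ih hlt h
      · exact hm
    · rw [List.dropWhile_cons_of_neg (by simpa using hm), List.length_cons, length_extendBy] at h
      simp at h
      omega

theorem reduced_extendBy {f : ℕ → Fin n} (hf : ∀ k, f k ≠ f (k + 1)) (m : ℕ) :
    Reduced (extendBy f [] m) := by
  induction m with
  | zero => exact List.IsChain.nil
  | succ m ih =>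
    refine reduced_cons.mpr ⟨mem_nextLabels.mpr fun h => ?_, ih⟩
    cases m with
    | zero => simp [extendBy] at h
    | succ m => exact hf m (by simpa [extendBy] using h)

/-- Pigeonhole: if small geodesics occur infinitely often along the ray, one of them contains
infinitely many of its edges. The ray then stays on it beyond its root, hence alternates. -/
theorem exists_periodic_or_large {a : Fin n → ℂ} {K : ℝ}
    (hfin : {γ : AltGeod n | ‖phi a γ‖ ≤ K}.Finite) {f : ℕ → Fin n}
    (hf : ∀ k, f k ≠ f (k + 1)) :
    (∃ M, ∀ k, f (M + k + 2) = f (M + k)) ∨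
    ∃ M, ∀ m ≥ M, ∀ i, i ≠ f m → K < ‖coProd (pathVec a (extendBy f [] (m + 1))) (f m) i‖ := by
  by_contra! hcon
  obtain ⟨hper, hsmall⟩ := hcon
  set A : AltGeod n → Set ℕ := fun γ =>
    {m | f m ∈ γ.1.1 ∧ geodAt γ.1 (extendBy f [] (m + 1)) = γ} with hA
  have hinf : ¬ (⋃ γ ∈ {γ : AltGeod n | ‖phi a γ‖ ≤ K}, A γ).Finite := by
    intro hf'
    obtain ⟨B, hB⟩ := hf'.bddAbove
    obtain ⟨m, hm, i, hi, hle⟩ := hsmall (B + 1)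
    have hmem : m ∈ ⋃ γ ∈ {γ : AltGeod n | ‖phi a γ‖ ≤ K}, A γ := by
      set I : {I : Finset (Fin n) // I.card = 2} := ⟨{f m, i}, Finset.card_pair hi.symm⟩
      refine Set.mem_biUnion (x := geodAt I (extendBy f [] (m + 1))) ?_ ⟨?_, rfl⟩
      · change ‖phi a (geodAt I (extendBy f [] (m + 1)))‖ ≤ K
        rw [phi_geodAt]
        exact hle
      · exact Finset.mem_insert_self _ _
    have := hB hmem
    omega
  have hex : ∃ γ, ¬ (A γ).Finite := by
    by_contra! hall
    exact hinf (hfin.biUnion fun γ _ => hall γ)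
  obtain ⟨γ, hγ⟩ := hex
  have hmem : ∀ k, (rootWord γ).length ≤ k → f k ∈ γ.1.1 := by
    intro k hk
    obtain ⟨m, hm, hkm⟩ := Set.Infinite.exists_gt hγ k
    refine mem_of_length_dropWhile_le f γ.1.1 (m + 1) k (by omega) ?_
    rw [← rootWord_geodAt γ.1 (reduced_extendBy hf _), hm.2]
    exact hk
  obtain ⟨p, q, -, hpq⟩ := Finset.card_eq_two.mp γ.1.2
  obtain ⟨k, hk⟩ := hper (rootWord γ).length
  set b := (rootWord γ).length
  have h0 := hmem (b + k) (by omega)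
  have h1 := hmem (b + k + 1) (by omega)
  have h2 := hmem (b + k + 2) (by omega)
  have e1 := hf (b + k)
  have e2 := hf (b + k + 1)
  rw [hpq] at h0 h1 h2
  simp only [Finset.mem_insert, Finset.mem_singleton] at h0 h1 h2
  grind

theorem exists_tame {a : Fin n → ℂ} (hn : 3 ≤ n) (ha : a ∈ domainD n) :
    ∃ ε K, Tame a ε K := by
  obtain ⟨hseg, K, hK, hfin⟩ := ha
  have hphi : ∀ l i j (hij : i ≠ j),
      phi a (geodAt ⟨{i, j}, Finset.card_pair hij⟩ l) = coProd (pathVec a l) i j :=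
    fun l i j hij => phi_geodAt a _ l
  -- Only finitely many |φ| are at most K, and none is zero; as m ≤ 1 < K, this minimum bounds the
  -- remaining ones as well.
  obtain ⟨m, h0, h1, hm⟩ := exists_pos_le_of_finset hfin.toFinset (fun γ => ‖phi a γ‖)
    (fun γ => norm_pos_iff.mpr (ne_zero_of_notMem_seg (hseg γ)))
  refine ⟨m, K, hn, fun l i j hij => ?_, h0, hK, fun l i j hij => ?_,
    fun f hf => exists_periodic_or_large hfin hf⟩
  · rw [← hphi l i j hij]
    exact hseg _
  · rw [← hphi l i j hij]
    by_cases hle : ‖phi a (geodAt ⟨{i, j}, Finset.card_pair hij⟩ l)‖ ≤ K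
    · exact hm _ (hfin.mem_toFinset.mpr hle)
    · linarith

theorem sigma_ne {a : Fin n → ℂ} {ε K : ℝ} (h : Tame a ε K) (γ : AltGeod n) :
    sigma a γ ≠ hurwitzPoly a := by
  obtain ⟨⟨⟨⟨I, hI⟩, l⟩, hr⟩, rfl⟩ := (geodEquiv n).symm.surjective γ
  obtain ⟨i, j, hij, rfl⟩ := Finset.card_eq_two.mp hI
  change sigma a (geodAt ⟨{i, j}, hI⟩ l.1) ≠ _
  rw [sigma_geodAt]
  change coSum (pathVec a l.1) i j ≠ _
  rw [← hurwitzPoly_pathVec (by have := h.three_le; omega) a l.1]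
  intro e
  have h1 := mul_coSum_sub (pathVec a l.1) hij (h.coProd_ne_zero _ hij)
  rw [e, sub_self, mul_zero] at h1
  rcases mul_eq_zero.mp h1.symm with h2 | h2
  · exact h.growing_ne_zero _ hij h2
  · rw [coProd_comm] at h2
    exact h.growing_ne_zero _ hij.symm h2

end Domain

end MarkoffHurwitz

theorem theorem1p5 (n : ℕ) (hn : 3 ≤ n) (μ : ℂ) (a : Fin n → ℂ)
    (ha : a ∈ MarkoffHurwitz.domainD n) (hμ : MarkoffHurwitz.hurwitzPoly a = μ) :
    (∀ γ : MarkoffHurwitz.AltGeod n, MarkoffHurwitz.sigma a γ ≠ μ) ∧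
    (Summable fun γ : MarkoffHurwitz.AltGeod n => ‖MarkoffHurwitz.hmu μ a γ‖) ∧
    HasSum (fun γ : MarkoffHurwitz.AltGeod n => MarkoffHurwitz.hmu μ a γ) 1 ∧
    (μ = 0 →
      (Summable fun γ : MarkoffHurwitz.AltGeod n =>
        ‖MarkoffHurwitz.hfun (MarkoffHurwitz.phi a γ)‖) ∧
      HasSum (fun γ : MarkoffHurwitz.AltGeod n =>
        MarkoffHurwitz.hfun (MarkoffHurwitz.phi a γ)) 1) := by
  open MarkoffHurwitz in
  obtain ⟨ε, K, h⟩ := exists_tame hn ha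
  obtain ⟨ρ, m, N, hg⟩ := h.exists_grows
  set S := ∑' l : {l : List (Fin n) // Reduced l}, (∏ k, pathVec a l.1 k)⁻¹
  have h1 : HasSum (fun γ : AltGeod n => hfun (phi a γ)) (1 + μ * S) := by
    rw [← (geodEquiv n).symm.hasSum_iff, ← hμ]
    refine Eq.mp (congrArg (fun f => HasSum f _) (funext fun r => ?_)) (h.hasSum_hfun hg)
    exact congrArg hfun (phi_geodAt a r.1.1 r.1.2.1).symm
  have h2 : HasSum (fun γ : AltGeod n => csqrt (1 - 4 / phi a γ ^ 2) / (sigma a γ - μ))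
      ((n : ℂ) * ((n : ℂ) - 1) / 2 * S) := by
    rw [← (geodEquiv n).symm.hasSum_iff, ← hμ]
    refine Eq.mp (congrArg (fun f => HasSum f _) (funext fun r => ?_)) (h.hasSum_csqrt_div hg)
    change _ = csqrt (1 - 4 / phi a (geodAt r.1.1 r.1.2.1) ^ 2) /
      (sigma a (geodAt r.1.1 r.1.2.1) - hurwitzPoly a)
    rw [phi_geodAt, sigma_geodAt]
  have hn0 : (n : ℂ) ≠ 0 := by
    have : n ≠ 0 := by omega
    exact_mod_cast this
  have hn1 : (n : ℂ) - 1 ≠ 0 := by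
    rw [sub_ne_zero]
    have : n ≠ 1 := by omega
    exact_mod_cast this
  have h3 : HasSum (fun γ : AltGeod n => hmu μ a γ) 1 := by
    have h4 := h1.sub (h2.mul_left (2 * μ / ((n : ℂ) * ((n : ℂ) - 1))))
    -- The vertex series `S` cancels here; this fixes the coefficient of the correction in 𝔥_μ.
    have e : 1 + μ * S - 2 * μ / ((n : ℂ) * ((n : ℂ) - 1)) *
        ((n : ℂ) * ((n : ℂ) - 1) / 2 * S) = 1 := by
      field_simp
      ring
    rw [e] at h4
    refine Eq.mp (congrArg (fun f => HasSum f _) (funext fun γ => ?_)) h4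
    rw [hmu, hfun, div_mul_eq_div_div (2 * μ) ((n : ℂ) * ((n : ℂ) - 1))]
    ring
  refine ⟨fun γ => hμ ▸ sigma_ne h γ, h3.summable.norm, h3, fun h0 => ?_⟩
  rw [h0, zero_mul, add_zero] at h1
  exact ⟨h1.summable.norm, h1⟩
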